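/- Let $F_N$ be the free group of rank $N$ and let $\mathrm{cv}_N\subset\mathbb R^{F_N}$ be unprojectivised Outer space, that is, the set of translation length functions of free, minimal, discrete, isometric actions of $F_N$ on $\mathbb R$-trees; put $\partial\mathrm{cv}_N=\overline{\mathrm{cv}}_N\setminus\mathrm{cv}_N$. Let $T$ be an $\mathbb R$-tree with a minimal isometric action of $F_N$ whose translation length function lies in $\partial\mathrm{cv}_N$. Assume that $T$ is indecomposable: for all non-degenerate arcs $I,J\subseteq T$ there are $g_1,\dots,g_r\in F_N$ such that $I\subseteq g_1J\cup\dots\cup g_rJ$ and such that $g_iJ\cap g_{i+1}J$ is non-degenerate for $1\le i<r$. Let $\hat T_w$ be the set $\hat T=\overline T\cup\partial T$ (the metric completion of $T$ together with its Gromov boundary), equipped with the weak (observers') topology, for which the directions, i.e. the connected components of the sets $\hat T\setminus\{x\}$ with $x\in\hat T$, form a subbasis; $F_N$ acts on $\hat T_w$ by the induced action. Let $Y$ be a dendrite, i.e. a compact, locally connected, uniquely arcwise connected metrizable space, on which $F_N$ acts by homeomorphisms, and let $p:\hat T_w\to Y$ be a continuous, surjective, $F_N$-equivariant map. Then one of the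 following holds: (a) $p$ is a homeomorphism, (b) $Y$ is a point, or (c) there is an open interval $Z\subset Y$ (a non-degenerate topological arc of $Y$ without its two endpoints; it need not be open in $Y$) such that $|p^{-1}(z)|>2$ for every $z\in Z$. -/

import Mathlib

open Filter Topology

noncomputable section

/-- The Gromov product `(x, y)_p` of `x` and `y` relative to the base point `p`. -/
def gromovProduct {X : Type*} [MetricSpace X] (p x y : X) : ℝ :=
  (dist x p + dist y p - dist x y) / 2

/-- An `ℝ`-tree: a nonempty metric space that is geodesic and `0`-hyperbolic. -/
class IsRTree (T : Type*) [MetricSpace T] : Prop where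
  nonempty : Nonempty T
  exists_geodesic : ∀ x y : T, ∃ γ : ℝ → T, γ 0 = x ∧ γ (dist x y) = y ∧
    ∀ s ∈ Set.Icc 0 (dist x y), ∀ t ∈ Set.Icc 0 (dist x y), dist (γ s) (γ t) = |s - t|
  zero_hyperbolic : ∀ p x y z : T,
    min (gromovProduct p x y) (gromovProduct p y z) ≤ gromovProduct p x z

/-! ### Group actions on `ℝ`-trees -/

section Actions

variable (G : Type*) [Group G] (T : Type*) [MetricSpace T] [MulAction G T]

/-- The action is minimal: there is no proper invariant subtree
(the subtrees of an `ℝ`-tree are its nonempty connected subsets). -/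
def IsMinimalTreeAction : Prop :=
  ∀ S : Set T, IsConnected S → (∀ g : G, ∀ x ∈ S, g • x ∈ S) → S = Set.univ

/-- The action is free: no nontrivial element fixes a point. -/
def IsFreeTreeAction : Prop :=
  ∀ g : G, g ≠ 1 → ∀ x : T, g • x ≠ x

/-- The action is discrete (simplicial): each orbit is a discrete subset. -/
def IsDiscreteTreeAction : Prop :=
  ∀ x : T, DiscreteTopology (MulAction.orbit G x)

/-- The translation length function `g ↦ inf_x d(x, g x)`. -/
def translationLength (g : G) : ℝ :=
  ⨅ x : T, dist x (g • x)

variable {T} in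
/-- A nondegenerate arc: a subset with more than one point that is isometric to a
segment of `ℝ`. -/
def IsNondegenerateArc (I : Set T) : Prop :=
  I.Nontrivial ∧ ∃ a b : ℝ, Nonempty (Set.Icc a b ≃ᵢ I)

/-- Indecomposability: for all nondegenerate arcs `I`, `J` there are `g₀, …, gᵣ` such that
`I` is covered by the `gᵢ J` and each `gᵢ J ∩ gᵢ₊₁ J` is nondegenerate. -/
def IsIndecomposable : Prop :=
  ∀ I J : Set T, IsNondegenerateArc I → IsNondegenerateArc J →
    ∃ (r : ℕ) (g : Fin (r + 1) → G),
      (I ⊆ ⋃ i, (fun x => g i • x) '' J) ∧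
      ∀ i : Fin r, (((fun x => g i.castSucc • x) '' J) ∩
        ((fun x => g i.succ • x) '' J)).Nontrivial

end Actions

/-- Unprojectivised Outer space of rank `N`, as a subset of `ℝ ^ F_N`: the translation length
functions of the free, minimal, discrete, isometric actions of `F_N` on `ℝ`-trees. (A minimal
`F_N`-tree has at most the cardinality of the continuum, so trees in `Type` suffice.) -/
def outerSpace (N : ℕ) : Set (FreeGroup (Fin N) → ℝ) :=
  {l | ∃ (S : Type) (_ : MetricSpace S) (_ : MulAction (FreeGroup (Fin N)) S),
    IsRTree S ∧ IsIsometricSMul (FreeGroup (Fin N)) S ∧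
    IsMinimalTreeAction (FreeGroup (Fin N)) S ∧ IsFreeTreeAction (FreeGroup (Fin N)) S ∧
    IsDiscreteTreeAction (FreeGroup (Fin N)) S ∧
    l = translationLength (FreeGroup (Fin N)) S}

/-- The boundary of unprojectivised Outer space: its closure in `ℝ ^ F_N` (with the topology of
pointwise convergence), minus the space itself. -/
def outerSpaceBoundary (N : ℕ) : Set (FreeGroup (Fin N) → ℝ) :=
  closure (outerSpace N) \ outerSpace N

/-- `T`, with its isometric action of `F_N`, is a point of the boundary of unprojectivised Outer
space: it is a minimal `F_N`-tree whose translation length function lies in the boundary. -/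
def MemOuterSpaceBoundary (N : ℕ) (T : Type*) [MetricSpace T] [IsRTree T]
    [MulAction (FreeGroup (Fin N)) T] [IsIsometricSMul (FreeGroup (Fin N)) T] : Prop :=
  IsMinimalTreeAction (FreeGroup (Fin N)) T ∧
    translationLength (FreeGroup (Fin N)) T ∈ outerSpaceBoundary N

/-! ### The Gromov boundary of an `ℝ`-tree -/

section Boundary

variable (T : Type*) [MetricSpace T]

/-- The sequences that converge at infinity: `(uₙ, uₘ)_p → ∞` as `n, m → ∞`. -/
def GromovSeq : Type _ :=
  {u : ℕ → T // ∀ p : T,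
    Tendsto (fun k : ℕ × ℕ => gromovProduct p (u k.1) (u k.2)) atTop atTop}

/-- Sequences are equivalent if `(uₙ, vₙ)_p → ∞`. -/
def gromovSeqSetoid [IsRTree T] : Setoid (GromovSeq T) where
  r u v := ∀ p : T, Tendsto (fun n => gromovProduct p (u.1 n) (v.1 n)) atTop atTop
  iseqv :=
    { refl := fun u p => (u.2 p).comp tendsto_atTop_diagonal
      symm := fun {u v} h p => by
        refine (h p).congr fun n => ?_
        unfold gromovProduct
        rw [dist_comm (u.1 n) (v.1 n)]; ring
      trans := fun {u v w} h k p => by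
        rw [tendsto_atTop]
        intro C
        filter_upwards [(tendsto_atTop.1 (h p)) C, (tendsto_atTop.1 (k p)) C] with n h1 h2
        exact (le_min h1 h2).trans (IsRTree.zero_hyperbolic p (u.1 n) (v.1 n) (w.1 n)) }

/-- The Gromov boundary `∂T`. -/
def GromovBoundary [IsRTree T] : Type _ :=
  Quotient (gromovSeqSetoid T)

end Boundary

/-! ### The space `T̂_w` -/

/-- The set `T̂`: the union of the metric completion of `T` and of the Gromov boundary of `T`.
It carries the weak topology, defined below. -/
inductive WeakHat (T : Type*) [MetricSpace T] [IsRTree T] : Type _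
  | pt (x : UniformSpace.Completion T)
  | bdry (ξ : GromovBoundary T)

namespace WeakHat

variable {T : Type*} [MetricSpace T] [IsRTree T]

/-- The sequences in the completion of `T` that represent a point of `T̂`: the constant sequence
for a point of the completion, the sequences in the class `ξ` for a boundary point `ξ`. -/
def reps : WeakHat T → Set (ℕ → UniformSpace.Completion T)
  | pt x => {fun _ => x}
  | bdry ξ => {w | ∃ u : GromovSeq T, Quotient.mk (gromovSeqSetoid T) u = ξ ∧
      w = fun n => (u.1 n : UniformSpace.Completion T)}

/-- `x` does not lie on the segment `[η, ζ]` of `T̂`, in other words `η` and `ζ` belong to the same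
connected component of `T̂ ∖ {x}`. For a point `x` of the completion this says that the Gromov
product of `η` and `ζ` relative to `x` is positive. The complement of a boundary point is
connected. -/
def SameDirection (x η ζ : WeakHat T) : Prop :=
  match x with
  | pt x => ∀ u ∈ reps η, ∀ v ∈ reps ζ, ∀ᶠ n in atTop, 0 < gromovProduct x (u n) (v n)
  | bdry ξ => η ≠ bdry ξ ∧ ζ ≠ bdry ξ

/-- The direction at `x` that contains `η`: the connected component of `η` in `T̂ ∖ {x}`. -/
def direction (x η : WeakHat T) : Set (WeakHat T) :=
  {ζ | SameDirection x η ζ}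

/-- The weak (observers') topology: the directions form a subbasis. -/
instance : TopologicalSpace (WeakHat T) :=
  TopologicalSpace.generateFrom {D | ∃ x η : WeakHat T, η ≠ x ∧ D = direction x η}

end WeakHat

/-! ### The induced action on `T̂` -/

section InducedAction

variable {G : Type*} [Group G] {T : Type*} [MetricSpace T] [MulAction G T] [IsIsometricSMul G T]

theorem gromovProduct_smul (g : G) (p x y : T) :
    gromovProduct p (g • x) (g • y) = gromovProduct (g⁻¹ • p) x y := by
  have h : ∀ z : T, dist (g • z) p = dist z (g⁻¹ • p) := fun z => by
    rw [← dist_smul g z (g⁻¹ • p), smul_inv_smul]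
  simp only [gromovProduct, dist_smul, h]

/-- An isometric action is uniformly continuous, hence extends to the completion. -/
instance : UniformContinuousConstSMul G T :=
  ⟨fun g => (isometry_smul T g).uniformContinuous⟩

instance : MulAction G (GromovSeq T) where
  smul g u := ⟨fun n => g • u.1 n, fun p =>
    (u.2 (g⁻¹ • p)).congr fun k => (gromovProduct_smul g p (u.1 k.1) (u.1 k.2)).symm⟩
  one_smul u := Subtype.ext (funext fun n => one_smul G (u.1 n))
  mul_smul g h u := Subtype.ext (funext fun n => mul_smul g h (u.1 n))

variable [IsRTree T]

instance : MulAction G (GromovBoundary T) where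
  smul g := Quotient.map (fun u : GromovSeq T => g • u) fun u v h p =>
    (h (g⁻¹ • p)).congr fun n => (gromovProduct_smul g p (u.1 n) (v.1 n)).symm
  one_smul ξ := by
    induction ξ using Quotient.inductionOn with
    | h u => exact congrArg (Quotient.mk (gromovSeqSetoid T)) (one_smul G u)
  mul_smul g h ξ := by
    induction ξ using Quotient.inductionOn with
    | h u => exact congrArg (Quotient.mk (gromovSeqSetoid T)) (mul_smul g h u)

/-- The action on `T̂` induced by the isometric action on `T`. -/
instance : MulAction G (WeakHat T) where
  smul g
    | .pt x => .pt (g • x)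
    | .bdry ξ => .bdry (g • ξ)
  one_smul
    | .pt x => congrArg WeakHat.pt (one_smul G x)
    | .bdry ξ => congrArg WeakHat.bdry (one_smul G ξ)
  mul_smul g h
    | .pt x => congrArg WeakHat.pt (mul_smul g h x)
    | .bdry ξ => congrArg WeakHat.bdry (mul_smul g h ξ)

end InducedAction

/-! ### Dendrites -/

section Dendrites

variable {Y : Type*} [TopologicalSpace Y]

/-- `A` is a topological arc with endpoints `x` and `y`. -/
def IsArcBetween (A : Set Y) (x y : Y) : Prop :=
  ∃ f : unitInterval → Y, IsEmbedding f ∧ f 0 = x ∧ f 1 = y ∧ Set.range f = A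

/-- `Z` is an open interval: a topological arc without its two (distinct) endpoints. -/
def IsOpenInterval (Z : Set Y) : Prop :=
  ∃ (A : Set Y) (x y : Y), IsArcBetween A x y ∧ Z = A \ {x, y}

variable (Y) in
/-- A dendrite: a nonempty compact, locally connected, uniquely arcwise connected metrizable
space. -/
structure IsDendrite : Prop where
  nonempty : Nonempty Y
  compact : CompactSpace Y
  metrizable : TopologicalSpace.MetrizableSpace Y
  locallyConnected : LocallyConnectedSpace Y
  uniqueArc : ∀ x y : Y, x ≠ y → ∃! A : Set Y, IsArcBetween A x y

end Dendrites

end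

/-!
Write `q` for the restriction of `p` to `T`. Suppose that every open interval of `Y` contains a
point with at most two preimages; the claim is that then `p` is constant or injective, which
suffices because `T̂` is compact. Of the hypotheses on the action, the argument uses that it is
isometric and indecomposable.

In a dendrite every path from `a` to `b` runs through all points of the arc from `a` to `b`
(`IsDendrite.arc_subset_image_path`), since the image of a path contains an arc with the same ends
(`exists_isArcBetween_subset`). So if `p` takes the same value at the two ends of a geodesic of `T̂`
without being constant on it, then an arc of `Y` is covered twice by the geodesic, and a point of
this arc with at most two preimages yields a *folded segment*: `s ≠ s'` in `T` such that `{s, s'}` is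
a fibre (`IsGeodesicTo.map_ne`). If `q` is constant on a nondegenerate arc, indecomposability makes
it constant (`eq_of_const_on_arc`).

Folded segments do not exist. Let `M` be the set of points of `T` that project to the interior of the
segment from `s` to `s'`. It is a union of fibres of `q` (`mem_middle_of_eq`): if `a ∈ M` and
`a' ∉ M` had the same image, then near `q s` all points of the arc towards `q a` would have three
preimages, one on each half of the folded segment and one on the way to `a'`. Now let `J` be a
translate of the folded segment that overlaps it near `s` and continues beyond `s`. As `J` has the
length of the folded segment, its end on the side of `s'` lies in `M`, its other end does not, and
both have the same image: a contradiction (`pos_or_eq_of_isBetween`). Therefore a chain of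
overlapping translates cannot pass through `s`, against indecomposability
(`false_of_folded_segment`).

Hence the two ends of a geodesic have different images. Two boundary points with the same image are
the ends of rays with a common origin that run along one arc of `Y`, and these rays coincide
(`eq_of_map_bdry_eq`). So `p` is injective.
-/

/-! ### Arcs in the image of a path -/

section PathArc

/-- A closed set `K ⊆ [0, 1]` containing `0` and `1` such that `f` takes the same value at the two
ends of every gap of `K`: cutting out the gaps leaves a path. -/
structure IsPathSkeleton {Y : Type*} (f : ℝ → Y) (K : Set ℝ) : Prop where
  isClosed : IsClosed K
  subset : K ⊆ Set.Icc 0 1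
  zero_mem : (0 : ℝ) ∈ K
  one_mem : (1 : ℝ) ∈ K
  gap : ∀ a ∈ K, ∀ b ∈ K, a < b → (∀ x ∈ K, ¬ (a < x ∧ x < b)) → f a = f b

/-- In a minimal skeleton, equal values occur only at the two ends of a gap: otherwise the points in
between could be removed. -/
theorem gap_of_minimal {Y : Type*} {f : ℝ → Y} {K : Set ℝ} (hK : Minimal (IsPathSkeleton f) K)
    {a b : ℝ} (ha : a ∈ K) (hb : b ∈ K) (hfab : f a = f b) :
    ∀ x ∈ K, ¬ (a < x ∧ x < b) := by
  have hs := hK.prop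
  have hnew : IsPathSkeleton f (K \ Set.Ioo a b) := by
    refine ⟨hs.isClosed.sdiff isOpen_Ioo, fun x hx => hs.subset hx.1,
      ⟨hs.zero_mem, fun h => ?_⟩, ⟨hs.one_mem, fun h => ?_⟩, ?_⟩
    · linarith [(hs.subset ha).1, h.1]
    · linarith [(hs.subset hb).2, h.2]
    intro a' ha' b' hb' hab' hgap
    by_cases hcase : ∀ x ∈ K, ¬ (a' < x ∧ x < b')
    · exact hs.gap a' ha'.1 b' hb'.1 hab' hcase
    push Not at hcase
    obtain ⟨x, hxK, hx1, hx2⟩ := hcase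
    have hx : x ∈ Set.Ioo a b := by
      by_contra h
      exact hgap x ⟨hxK, h⟩ ⟨hx1, hx2⟩
    have h1 : a ≤ a' := by
      by_contra! h
      exact hgap a ⟨ha, fun h => lt_irrefl _ h.1⟩ ⟨h, hx.1.trans hx2⟩
    have h2 : b' ≤ b := by
      by_contra! h
      exact hgap b ⟨hb, fun h => lt_irrefl _ h.2⟩ ⟨hx1.trans hx.2, h⟩
    have h3 : a' = a := by
      by_contra h
      exact ha'.2 ⟨lt_of_le_of_ne h1 (Ne.symm h), hx1.trans hx.2⟩
    have h4 : b' = b := by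
      by_contra h
      exact hb'.2 ⟨hx.1.trans hx2, lt_of_le_of_ne h2 h⟩
    rw [h3, h4, hfab]
  intro x hx hxab
  exact (hK.le_of_le hnew Set.sdiff_subset hx).2 hxab

variable {Y : Type*} [MetricSpace Y]

theorem IsPathSkeleton.sInter {f : ℝ → Y} (hf : Continuous f) {c : Set (Set ℝ)}
    (hc : ∀ K ∈ c, IsPathSkeleton f K) (hchain : IsChain (· ⊆ ·) c) (hne : c.Nonempty) :
    IsPathSkeleton f (⋂₀ c) := by
  refine ⟨isClosed_sInter fun K hK => (hc K hK).isClosed, ?_, ?_, ?_, ?_⟩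
  · obtain ⟨K, hK⟩ := hne
    exact (Set.sInter_subset_of_mem hK).trans (hc K hK).subset
  · exact fun K hK => (hc K hK).zero_mem
  · exact fun K hK => (hc K hK).one_mem
  intro a ha b hb hab hgap
  -- By compactness some member of the chain has a gap that is almost the whole of `(a, b)`.
  refine dist_le_zero.1 (le_of_forall_pos_le_add fun ε hε => ?_)
  obtain ⟨δ₁, hδ₁, h₁⟩ := Metric.continuous_iff.1 hf a (ε / 2) (by positivity)
  obtain ⟨δ₂, hδ₂, h₂⟩ := Metric.continuous_iff.1 hf b (ε / 2) (by positivity)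
  obtain ⟨δ, hδ, hd1, hd2, hd3⟩ : ∃ δ : ℝ, 0 < δ ∧ δ < δ₁ ∧ δ < δ₂ ∧ δ < (b - a) / 2 := by
    refine ⟨min (min δ₁ δ₂) ((b - a) / 2) / 2, ?_, ?_, ?_, ?_⟩
    · have : 0 < b - a := by linarith
      positivity
    all_goals
      have hpos : 0 < min (min δ₁ δ₂) ((b - a) / 2) := by
        have : 0 < b - a := by linarith
        positivity
      have e1 := min_le_left (min δ₁ δ₂) ((b - a) / 2)
      have e2 := min_le_right (min δ₁ δ₂) ((b - a) / 2)
      have e3 := min_le_left δ₁ δ₂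
      have e4 := min_le_right δ₁ δ₂
      linarith
  have hempty : Set.Icc (a + δ) (b - δ) ∩ ⋂ K : c, (K : Set ℝ) = ∅ := by
    ext x
    simp only [Set.mem_inter_iff, Set.mem_Icc, Set.mem_iInter, Set.mem_empty_iff_false, iff_false]
    rintro ⟨⟨hx1, hx2⟩, hx⟩
    exact hgap x (fun K hK => hx ⟨K, hK⟩) ⟨by linarith, by linarith⟩
  have : Nonempty c := hne.to_subtype
  obtain ⟨⟨K, hK⟩, hKe⟩ := isCompact_Icc.elim_directed_family_closed
    (fun K : c => (K : Set ℝ)) (fun K => (hc K K.2).isClosed) hempty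
    (by
      rintro ⟨A, hA⟩ ⟨B, hB⟩
      rcases hchain.total hA hB with h | h
      · exact ⟨⟨A, hA⟩, subset_rfl, h⟩
      · exact ⟨⟨B, hB⟩, h, subset_rfl⟩)
  have haK : a ∈ K := ha K hK
  have hbK : b ∈ K := hb K hK
  obtain ⟨a', ⟨ha'K, ha'1, ha'2⟩, ha'm⟩ :=
    ((isCompact_Icc (a := a) (b := a + δ)).inter_left (hc K hK).isClosed).exists_isGreatest
      ⟨a, haK, le_rfl, by linarith⟩
  obtain ⟨b', ⟨hb'K, hb'1, hb'2⟩, hb'm⟩ :=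
    ((isCompact_Icc (a := b - δ) (b := b)).inter_left (hc K hK).isClosed).exists_isLeast
      ⟨b, hbK, by linarith, le_rfl⟩
  have heq : f a' = f b' := by
    refine (hc K hK).gap a' ha'K b' hb'K (by linarith) fun x hxK hx => ?_
    rcases le_or_gt x (a + δ) with h | h
    · have := ha'm ⟨hxK, by linarith [hx.1], h⟩
      linarith [hx.1]
    rcases le_or_gt (b - δ) x with h' | h'
    · have := hb'm ⟨hxK, h', by linarith [hx.2]⟩
      linarith [hx.2]
    · have : x ∈ Set.Icc (a + δ) (b - δ) ∩ K := ⟨⟨h.le, h'.le⟩, hxK⟩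
      rw [hKe] at this
      exact this
  have d1 := h₁ a' (by rw [Real.dist_eq, abs_of_nonneg (by linarith)]; linarith)
  have d2 := h₂ b' (by rw [Real.dist_eq, abs_of_nonpos (by linarith)]; linarith)
  have := dist_triangle (f a) (f a') (f b)
  rw [dist_comm (f a) (f a')] at this
  rw [heq] at this d1
  linarith

theorem exists_minimal_pathSkeleton {f : ℝ → Y} (hf : Continuous f) :
    ∃ K, Minimal (IsPathSkeleton f) K := by
  obtain ⟨K, -, hK⟩ := zorn_superset_nonempty {K | IsPathSkeleton f K}
    (fun c hc hchain hne => ⟨⋂₀ c, IsPathSkeleton.sInter hf hc hchain hne,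
      fun s hs => Set.sInter_subset_of_mem hs⟩) (Set.Icc 0 1)
    ⟨isClosed_Icc, subset_rfl, ⟨le_rfl, zero_le_one⟩, ⟨zero_le_one, le_rfl⟩,
      fun a ha b hb hab h => absurd (h ((a + b) / 2)
        ⟨by linarith [ha.1, hb.1], by linarith [ha.2, hb.2]⟩) (by
          rw [not_not]; constructor <;> linarith)⟩
  exact ⟨K, hK⟩

/-- A path can be replaced by one with the same ends, inside its image, whose fibres are
intervals. -/
theorem exists_monotone_path {f : ℝ → Y} (hf : Continuous f) :
    ∃ g : ℝ → Y, ContinuousOn g (Set.Icc 0 1) ∧ g 0 = f 0 ∧ g 1 = f 1 ∧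
      (∀ t ∈ Set.Icc (0 : ℝ) 1, g t ∈ f '' Set.Icc 0 1) ∧
      ∀ s t, 0 ≤ s → t ≤ 1 → s ≤ t → g s = g t → ∀ r, s ≤ r → r ≤ t → g r = g s := by
  obtain ⟨K, hK⟩ := exists_minimal_pathSkeleton hf
  have hs := hK.prop
  -- `l t` and `r t` are the nearest points of `K` to the left and to the right of `t`.
  have hl : ∀ t : ℝ, ∃ x, t ∈ Set.Icc (0 : ℝ) 1 → IsGreatest (K ∩ Set.Icc 0 t) x := by
    intro t
    by_cases ht : t ∈ Set.Icc (0 : ℝ) 1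
    · obtain ⟨x, hx⟩ := ((isCompact_Icc (a := 0) (b := t)).inter_left
        hs.isClosed).exists_isGreatest ⟨0, hs.zero_mem, le_rfl, ht.1⟩
      exact ⟨x, fun _ => hx⟩
    · exact ⟨0, fun h => absurd h ht⟩
  have hr : ∀ t : ℝ, ∃ x, t ∈ Set.Icc (0 : ℝ) 1 → IsLeast (K ∩ Set.Icc t 1) x := by
    intro t
    by_cases ht : t ∈ Set.Icc (0 : ℝ) 1
    · obtain ⟨x, hx⟩ := ((isCompact_Icc (a := t) (b := 1)).inter_left
        hs.isClosed).exists_isLeast ⟨1, hs.one_mem, ht.2, le_rfl⟩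
      exact ⟨x, fun _ => hx⟩
    · exact ⟨0, fun h => absurd h ht⟩
  choose l hl using hl
  choose r hr using hr
  have hlr : ∀ t ∈ Set.Icc (0 : ℝ) 1, f (l t) = f (r t) := by
    intro t ht
    have h1 := hl t ht
    have h2 := hr t ht
    rcases (h1.1.2.2.trans h2.1.2.1).eq_or_lt with h | h
    · rw [h]
    · refine hs.gap _ h1.1.1 _ h2.1.1 h fun x hx hxx => ?_
      rcases le_total x t with h' | h'
      · linarith [h1.2 ⟨hx, (hs.subset hx).1, h'⟩, hxx.1]
      · linarith [h2.2 ⟨hx, h', (hs.subset hx).2⟩, hxx.2]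
  have hlK : ∀ t ∈ K, l t = t := fun t ht =>
    le_antisymm (hl t (hs.subset ht)).1.2.2
      ((hl t (hs.subset ht)).2 ⟨ht, (hs.subset ht).1, le_rfl⟩)
  have hmono : ∀ s t, 0 ≤ s → t ≤ 1 → s ≤ t → l s ≤ l t := fun s t h0 h1 hst => by
    have hs' := (hl s ⟨h0, hst.trans h1⟩).1
    exact (hl t ⟨h0.trans hst, h1⟩).2 ⟨hs'.1, hs'.2.1, hs'.2.2.trans hst⟩
  refine ⟨fun t => f (l t), ?_, ?_, ?_, ?_, ?_⟩
  · intro t ht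
    by_cases htK : t ∈ K
    · rw [Metric.continuousWithinAt_iff]
      intro ε hε
      obtain ⟨δ, hδ, h⟩ := Metric.continuous_iff.1 hf t ε hε
      refine ⟨δ, hδ, fun {x} hx hxt => ?_⟩
      simp only [hlK t htK]
      rw [Real.dist_eq, abs_lt] at hxt
      rcases le_total t x with h' | h'
      · have h1 := (hl x hx).2 ⟨htK, ht.1, h'⟩
        have h2 := (hl x hx).1.2.2
        exact h _ (by rw [Real.dist_eq, abs_lt]; constructor <;> linarith)
      · rw [hlr x hx]
        have h1 := (hr x hx).2 ⟨htK, h', ht.2⟩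
        have h2 := (hr x hx).1.2.1
        exact h _ (by rw [Real.dist_eq, abs_lt]; constructor <;> linarith)
    · obtain ⟨δ, hδ, h⟩ := Metric.isOpen_iff.1 hs.isClosed.isOpen_compl t htK
      have : (fun x => f (l x)) =ᶠ[𝓝[Set.Icc 0 1] t] fun _ => f (l t) := by
        filter_upwards [self_mem_nhdsWithin,
          mem_nhdsWithin_of_mem_nhds (Metric.ball_mem_nhds t hδ)] with x hx hxt
        congr 1
        rw [Metric.mem_ball, Real.dist_eq, abs_lt] at hxt
        rcases le_total x t with h' | h'
        · refine le_antisymm (hmono _ _ hx.1 ht.2 h') ?_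
          have h1 := (hl t ht).1
          refine (hl x hx).2 ⟨h1.1, h1.2.1, ?_⟩
          by_contra! hc
          exact h (a := l t) (by
            rw [Metric.mem_ball, Real.dist_eq, abs_lt]
            constructor <;> linarith [h1.2.2]) h1.1
        · refine le_antisymm ?_ (hmono _ _ ht.1 hx.2 h')
          have h1 := (hl x hx).1
          refine (hl t ht).2 ⟨h1.1, h1.2.1, ?_⟩
          by_contra! hc
          exact h (a := l x) (by
            rw [Metric.mem_ball, Real.dist_eq, abs_lt]
            constructor <;> linarith [h1.2.2]) h1.1
      exact (continuousWithinAt_const (b := f (l t))).congr_of_eventuallyEq this rfl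
  · simp only [hlK 0 hs.zero_mem]
  · simp only [hlK 1 hs.one_mem]
  · exact fun t ht => ⟨l t, hs.subset (hl t ht).1.1, rfl⟩
  · intro s t h0 h1 hst heq x hsx hxt
    have e1 := hmono s x h0 (hxt.trans h1) hsx
    have e2 := hmono x t (h0.trans hsx) h1 hxt
    have k1 := (hl s ⟨h0, hst.trans h1⟩).1.1
    have k2 := (hl x ⟨h0.trans hsx, hxt.trans h1⟩).1.1
    have k3 := (hl t ⟨h0.trans hst, h1⟩).1.1
    rcases e1.eq_or_lt with h | h
    · simp only [h]
    rcases e2.eq_or_lt with h' | h'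
    · simp only [h', heq]
    · exact absurd ⟨h, h'⟩ (gap_of_minimal hK k1 k3 heq _ k2)

/-- For a path `g` whose fibres are intervals there is a monotone function with the same fibres. It
is a weighted sum of the functions `t ↦ sup_{s ≤ t} u (g s)`, where `u` runs over countably many
functions that separate the points of the image from its compact subsets. -/
theorem exists_height_function {g : ℝ → Y} (hg : ContinuousOn g (Set.Icc 0 1))
    (hfib : ∀ s t, 0 ≤ s → t ≤ 1 → s ≤ t → g s = g t → ∀ r, s ≤ r → r ≤ t → g r = g s) :
    ∃ h : unitInterval → ℝ, Continuous h ∧ Monotone h ∧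
      ∀ s t : unitInterval, h s = h t ↔ g s = g t := by
  let G : unitInterval → Y := fun t => g t
  have hG : Continuous G := continuousOn_iff_continuous_domRestrict.1 hg
  obtain ⟨D, hDc, hDd⟩ := TopologicalSpace.exists_countable_dense unitInterval
  have : Countable D := hDc.to_subtype
  let ι := D × ℚ
  let u : ι → Y → ℝ := fun i y => max 0 (min 1 (i.2 - dist y (G i.1)))
  have hu : ∀ i, Continuous (u i) := fun i => by fun_prop
  let F : ι → unitInterval → ℝ := fun i t => sSup ((fun s => u i (G (min s t))) '' Set.univ)
  have hFc : ∀ i, Continuous (F i) := fun i => by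
    refine IsCompact.continuous_sSup (f := fun t s => u i (G (min s t))) isCompact_univ ?_
    exact (hu i).comp (hG.comp (by fun_prop))
  have hu0 : ∀ i y, 0 ≤ u i y := fun i y => le_max_left _ _
  have hu1 : ∀ i y, u i y ≤ 1 := fun i y => max_le zero_le_one (min_le_left _ _)
  have hbdd : ∀ i t, BddAbove ((fun s => u i (G (min s t))) '' Set.univ) := fun i t =>
    ⟨1, by rintro _ ⟨s, -, rfl⟩; exact hu1 _ _⟩
  have hF0 : ∀ i t, 0 ≤ F i t := fun i t =>
    Real.sSup_nonneg (by rintro _ ⟨s, -, rfl⟩; exact hu0 _ _)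
  have hF1 : ∀ i t, F i t ≤ 1 := fun i t =>
    Real.sSup_le (by rintro _ ⟨s, -, rfl⟩; exact hu1 _ _) zero_le_one
  have hFm : ∀ i, Monotone (F i) := fun i t t' htt => by
    refine csSup_le ⟨_, ⟨0, trivial, rfl⟩⟩ ?_
    rintro _ ⟨s, -, rfl⟩
    refine le_csSup (hbdd i t') ⟨min s t, trivial, ?_⟩
    simp only [min_eq_left ((min_le_right s t).trans htt)]
  obtain ⟨w, hw0, hws⟩ : ∃ w : ι → ℝ, (∀ i, 0 < w i) ∧ Summable w := by
    have := Encodable.ofCountable ι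
    obtain ⟨w, hw, c, hc, -⟩ := posSumOfEncodable one_pos ι
    exact ⟨w, hw, hc.summable⟩
  have hsum : ∀ t, Summable fun i => w i * F i t := fun t =>
    Summable.of_nonneg_of_le (fun i => mul_nonneg (hw0 i).le (hF0 i t))
      (fun i => mul_le_of_le_one_right (hw0 i).le (hF1 i t)) hws
  let h : unitInterval → ℝ := fun t => ∑' i, w i * F i t
  have hmono : Monotone h := fun s t hst => (hsum s).tsum_le_tsum
    (fun i => mul_le_mul_of_nonneg_left (hFm i hst) (hw0 i).le) (hsum t)
  have hlt : ∀ s t : unitInterval, s ≤ t → g s = g t → h s = h t := by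
    intro s t hst heq
    have : ∀ i, F i s = F i t := fun i => by
      refine le_antisymm (hFm i hst) (csSup_le ⟨_, ⟨0, trivial, rfl⟩⟩ ?_)
      rintro _ ⟨r, -, rfl⟩
      refine le_csSup (hbdd i s) ⟨r, trivial, ?_⟩
      have : G (min r s) = G (min r t) := by
        rcases le_total r s with h' | h'
        · rw [min_eq_left h', min_eq_left (h'.trans hst)]
        · rw [min_eq_right h']
          exact (hfib s t s.2.1 t.2.2 hst heq _ (le_min h' hst) (min_le_right r t)).symm
      simp only [this]
    simp only [h, this]
  have hlt' : ∀ s t : unitInterval, s ≤ t → g s ≠ g t → h s < h t := by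
    intro s t hst hne
    have hnot : G t ∉ G '' Set.Iic s := by
      rintro ⟨r, hr, heq⟩
      refine hne ?_
      have := hfib r t r.2.1 t.2.2 (le_trans hr hst) heq s hr hst
      exact this.trans heq
    have hcl : IsClosed (G '' Set.Iic s) := (isClosed_Iic.isCompact.image hG).isClosed
    obtain ⟨ε, hε, hball⟩ := Metric.isOpen_iff.1 hcl.isOpen_compl _ hnot
    obtain ⟨d, hdD, hdε⟩ := hDd.exists_mem_open
      ((Metric.isOpen_ball (x := G t) (ε := ε / 2)).preimage hG)
      ⟨t, Metric.mem_ball_self (by positivity)⟩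
    replace hdε : dist (G d) (G t) < ε / 2 := hdε
    obtain ⟨ρ, hρ1, hρ2⟩ := exists_rat_btwn hdε
    let i : ι := (⟨d, hdD⟩, ρ)
    have hs0 : F i s ≤ 0 := by
      refine csSup_le ⟨_, ⟨0, trivial, rfl⟩⟩ ?_
      rintro _ ⟨r, -, rfl⟩
      refine max_le le_rfl ((min_le_right _ _).trans ?_)
      have h1 : ¬ dist (G (min r s)) (G t) < ε := fun h1 =>
        hball h1 ⟨_, min_le_right r s, rfl⟩
      have h2 := dist_triangle (G (min r s)) (G d) (G t)
      have : (i.2 : ℝ) = ρ := rfl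
      have h3 : G (i.1 : unitInterval) = G d := rfl
      rw [h3, this]
      linarith
    have ht0 : 0 < F i t := by
      refine lt_of_lt_of_le ?_ (le_csSup (hbdd i t) ⟨t, trivial, rfl⟩)
      simp only [min_self]
      refine lt_max_of_lt_right (lt_min one_pos ?_)
      rw [dist_comm]
      exact sub_pos.2 hρ1
    exact Summable.tsum_lt_tsum (i := i)
      (fun j => mul_le_mul_of_nonneg_left (hFm j hst) (hw0 j).le)
      (mul_lt_mul_of_pos_left (hs0.trans_lt ht0) (hw0 i)) (hsum s) (hsum t)
  refine ⟨h, ?_, hmono, fun s t => ?_⟩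
  · refine continuous_tsum (u := w) (fun i => (hFc i).const_mul _ |>.congr fun _ => rfl) hws ?_
    intro i t
    rw [Real.norm_of_nonneg (mul_nonneg (hw0 i).le (hF0 i t))]
    exact mul_le_of_le_one_right (hw0 i).le (hF1 i t)
  · rcases le_total s t with hst | hst
    · exact ⟨fun e => by_contra fun hne => (hlt' s t hst hne).ne e, hlt s t hst⟩
    · exact ⟨fun e => by_contra fun hne => (hlt' t s hst (Ne.symm hne)).ne e.symm,
        fun e => (hlt t s hst e.symm).symm⟩

/-- The image of a path with distinct ends contains an arc with the same ends. -/
theorem exists_isArcBetween_subset {f : ℝ → Y} (hf : Continuous f) (hne : f 0 ≠ f 1) :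
    ∃ A, IsArcBetween A (f 0) (f 1) ∧ A ⊆ f '' Set.Icc 0 1 := by
  obtain ⟨g, hg, hg0, hg1, hgr, hfib⟩ := exists_monotone_path hf
  obtain ⟨h, hh, hmono, hiff⟩ := exists_height_function hg hfib
  have h01 : h 0 < h 1 := lt_of_le_of_ne (hmono zero_le_one) fun e => hne (by
    rw [← hg0, ← hg1]
    simpa using (hiff 0 1).1 e)
  have hpos : 0 < h 1 - h 0 := sub_pos.2 h01
  let H : unitInterval → unitInterval := fun t => ⟨(h t - h 0) / (h 1 - h 0), by
    constructor
    · exact div_nonneg (sub_nonneg.2 (hmono unitInterval.nonneg')) hpos.le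
    · rw [div_le_one hpos]
      linarith [hmono (unitInterval.le_one' (t := t))]⟩
  have hH : Continuous H := by fun_prop
  have hH0 : H 0 = 0 := Subtype.ext (by simp [H])
  have hH1 : H 1 = 1 := Subtype.ext (by simp [H, div_self hpos.ne'])
  have hHs : Function.Surjective H := fun x => by
    obtain ⟨t, ht⟩ := mem_range_of_exists_le_of_exists_ge hH
      ⟨0, hH0.le.trans unitInterval.nonneg'⟩ ⟨1, unitInterval.le_one'.trans hH1.ge⟩ (c := x)
    exact ⟨t, ht⟩
  have hHe : ∀ s t, H s = H t ↔ g s = g t := fun s t => by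
    rw [← hiff, Subtype.ext_iff]
    simp only [H]
    rw [div_left_inj' hpos.ne', sub_left_inj]
  let F : unitInterval → Y := fun x => g (Function.surjInv hHs x : unitInterval)
  have hFH : ∀ t, F (H t) = g t := fun t => (hHe _ _).1 (Function.surjInv_eq hHs _)
  have hFc : Continuous F := by
    rw [(hH.isClosedMap.isQuotientMap hH hHs).continuous_iff]
    have : F ∘ H = fun t : unitInterval => g t := funext hFH
    rw [this]
    exact continuousOn_iff_continuous_domRestrict.1 hg
  have hFi : Function.Injective F := fun x y e => by
    obtain ⟨s, rfl⟩ := hHs x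
    obtain ⟨t, rfl⟩ := hHs y
    rw [hFH, hFH] at e
    exact (hHe s t).2 e
  refine ⟨Set.range F, ⟨F, (hFc.isClosedEmbedding hFi).isEmbedding, ?_, ?_, rfl⟩, ?_⟩
  · rw [← hH0, hFH, ← hg0]; rfl
  · rw [← hH1, hFH, ← hg1]; rfl
  · rintro _ ⟨x, rfl⟩
    exact hgr _ (Function.surjInv hHs x).2

end PathArc

section Dendrites

variable {Y : Type*} [TopologicalSpace Y]

/-- In a dendrite every path from `a` to `b` runs through all points of the arc from `a` to `b`. -/
theorem IsDendrite.arc_subset_image_path (hY : IsDendrite Y) {A : Set Y} {a b : Y}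
    (hA : IsArcBetween A a b) (hab : a ≠ b) {f : ℝ → Y} (hf : ContinuousOn f (Set.Icc 0 1))
    (h0 : f 0 = a) (h1 : f 1 = b) : A ⊆ f '' Set.Icc 0 1 := by
  have := hY.metrizable
  let _ := TopologicalSpace.metrizableSpaceMetric Y
  have hext : ∀ t ∈ Set.Icc (0 : ℝ) 1,
      Set.IccExtend zero_le_one (Set.domRestrict (Set.Icc 0 1) f) t = f t :=
    fun t ht => Set.IccExtend_of_mem _ _ ht
  have e0 := hext 0 ⟨le_rfl, zero_le_one⟩
  have e1 := hext 1 ⟨zero_le_one, le_rfl⟩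
  obtain ⟨B, hB, hBs⟩ := exists_isArcBetween_subset
    (f := Set.IccExtend zero_le_one (Set.domRestrict (Set.Icc 0 1) f))
    ((continuousOn_iff_continuous_domRestrict.1 hf).Icc_extend')
    (by rw [e0, e1, h0, h1]; exact hab)
  rw [e0, e1, h0, h1] at hB
  rw [(hY.uniqueArc a b hab).unique hA hB]
  intro y hy
  obtain ⟨t, ht, rfl⟩ := hBs hy
  exact ⟨t, ht, (hext t ht).symm⟩

end Dendrites

/-! ### Betweenness in `ℝ`-trees -/

/-- `c` lies on the segment from `x` to `y`. -/
def IsBetween {X : Type*} [MetricSpace X] (x c y : X) : Prop :=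
  dist x c + dist c y = dist x y

section MetricSpace

variable {X : Type*} [MetricSpace X]

theorem gromovProduct_comm (p x y : X) : gromovProduct p x y = gromovProduct p y x := by
  simp only [gromovProduct, dist_comm x y]; ring

theorem gromovProduct_nonneg (p x y : X) : 0 ≤ gromovProduct p x y := by
  have := dist_triangle x p y
  rw [dist_comm p y] at this
  unfold gromovProduct; linarith

theorem gromovProduct_le_dist (p x y : X) : gromovProduct p x y ≤ dist p x := by
  have := dist_triangle y x p
  rw [dist_comm y x, dist_comm x p] at this
  unfold gromovProduct; rw [dist_comm x p]; linarith

theorem gromovProduct_le_add_dist (p q x y : X) :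
    gromovProduct p x y ≤ gromovProduct q x y + dist p q := by
  have h1 := dist_triangle x q p
  have h2 := dist_triangle y q p
  rw [dist_comm q p] at h1 h2
  unfold gromovProduct; linarith

theorem gromovProduct_self (p x : X) : gromovProduct p x x = dist p x := by
  unfold gromovProduct; rw [dist_self, dist_comm x p]; ring

theorem IsBetween.symm {x c y : X} (h : IsBetween x c y) : IsBetween y c x := by
  unfold IsBetween at *
  rw [dist_comm y c, dist_comm c x, dist_comm y x]; linarith

theorem isBetween_left (x y : X) : IsBetween x x y := by simp [IsBetween]

theorem isBetween_right (x y : X) : IsBetween x y y := by simp [IsBetween]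

theorem gromovProduct_eq_zero_iff {p x y : X} : gromovProduct p x y = 0 ↔ IsBetween x p y := by
  unfold gromovProduct IsBetween
  rw [dist_comm p y]
  constructor <;> intro h <;> linarith

theorem gromovProduct_pos_iff {p x y : X} : 0 < gromovProduct p x y ↔ ¬ IsBetween x p y := by
  rw [← gromovProduct_eq_zero_iff, (gromovProduct_nonneg p x y).lt_iff_ne, ne_comm]

/-- Two points are in the same direction at `p` if the second is closer to the first than `p`. -/
theorem gromovProduct_pos_of_dist_lt {p x y : X} (h : dist x y < dist x p) :
    0 < gromovProduct p x y := by
  rw [gromovProduct_pos_iff]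
  intro hb
  have : 0 ≤ dist p y := dist_nonneg
  unfold IsBetween at hb; linarith

theorem IsBetween.dist_le_left {x c y : X} (h : IsBetween x c y) : dist x c ≤ dist x y := by
  have : 0 ≤ dist c y := dist_nonneg
  unfold IsBetween at h; linarith

theorem IsBetween.gromovProduct_eq {x c y : X} (h : IsBetween x c y) :
    gromovProduct x c y = dist x c := by
  unfold IsBetween at h; unfold gromovProduct
  rw [dist_comm c x, dist_comm y x]; linarith

theorem IsBetween.eq_of_self {x c : X} (h : IsBetween x c x) : c = x := by
  unfold IsBetween at h
  rw [dist_self, dist_comm c x] at h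
  have : dist x c = 0 := by linarith
  exact (dist_eq_zero.1 this).symm

theorem IsBetween.image_isometry {Z : Type*} [MetricSpace Z] {f : X → Z} (hf : Isometry f)
    {x c y : X} : IsBetween (f x) (f c) (f y) ↔ IsBetween x c y := by
  simp only [IsBetween, hf.dist_eq]

end MetricSpace

namespace IsRTree

variable {X : Type*} [MetricSpace X] [IsRTree X]

/-- The four point condition. -/
theorem four_point (x y z w : X) :
    dist x z + dist y w ≤ max (dist x y + dist z w) (dist y z + dist x w) := by
  have h := zero_hyperbolic w x y z
  unfold gromovProduct at h
  rcases min_le_iff.1 h with h | h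
  · exact le_max_of_le_left (by linarith)
  · exact le_max_of_le_right (by linarith)

theorem gromovProduct_pos_trans {p x y z : X} (h1 : 0 < gromovProduct p x y)
    (h2 : 0 < gromovProduct p y z) : 0 < gromovProduct p x z :=
  (lt_min h1 h2).trans_le (zero_hyperbolic p x y z)

theorem exists_between (x y : X) {t : ℝ} (h0 : 0 ≤ t) (h1 : t ≤ dist x y) :
    ∃ c, IsBetween x c y ∧ dist x c = t := by
  obtain ⟨γ, g0, g1, h⟩ := exists_geodesic x y
  have e1 := h 0 ⟨le_rfl, dist_nonneg⟩ t ⟨h0, h1⟩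
  have e2 := h t ⟨h0, h1⟩ (dist x y) ⟨dist_nonneg, le_rfl⟩
  rw [g0, zero_sub, abs_neg, abs_of_nonneg h0] at e1
  rw [g1, abs_of_nonpos (by linarith)] at e2
  exact ⟨γ t, by unfold IsBetween; linarith, e1⟩

theorem eq_of_isBetween {x y c c' : X} (h : IsBetween x c y) (h' : IsBetween x c' y)
    (hd : dist x c = dist x c') : c = c' := by
  have := four_point x c y c'
  unfold IsBetween at h h'
  rw [dist_comm y c'] at this
  refine dist_le_zero.1 ?_
  rcases le_max_iff.1 this with h1 | h1 <;> linarith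

/-- Points on a common segment are ordered by their distance from its first end. -/
theorem isBetween_of_dist_le {x y c c' : X} (h : IsBetween x c y) (h' : IsBetween x c' y)
    (hd : dist x c ≤ dist x c') : IsBetween x c c' ∧ IsBetween c c' y := by
  have := four_point x c y c'
  have t1 := dist_triangle x c c'
  have t2 := dist_triangle c c' y
  unfold IsBetween at *
  rw [dist_comm y c'] at this
  rcases le_max_iff.1 this with h1 | h1 <;> constructor <;> linarith

omit [IsRTree X] in
theorem isBetween_trans_left {x y c c' : X} (h : IsBetween x c' y) (h' : IsBetween x c c') :
    IsBetween x c y ∧ IsBetween c c' y := by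
  have t1 := dist_triangle x c y
  have t2 := dist_triangle c c' y
  unfold IsBetween at *
  constructor <;> linarith

omit [IsRTree X] in
theorem isBetween_trans_right {x y c c' : X} (h : IsBetween x c y) (h' : IsBetween c c' y) :
    IsBetween x c' y ∧ IsBetween x c c' := by
  have t1 := dist_triangle x c' y
  have t2 := dist_triangle x c c'
  unfold IsBetween at *
  constructor <;> linarith

/-- The median of three points. -/
theorem exists_median (x y z : X) :
    ∃ m, IsBetween x m y ∧ IsBetween x m z ∧ IsBetween y m z := by
  obtain ⟨m, hm, hd⟩ := exists_between x y (gromovProduct_nonneg x y z) (gromovProduct_le_dist x y z)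
  refine ⟨m, hm, ?_⟩
  have h1 := four_point x m y z
  have t1 := dist_triangle x m z
  have t2 := dist_triangle y m z
  unfold gromovProduct at hd
  unfold IsBetween at *
  rw [dist_comm y x, dist_comm z x] at hd
  rw [dist_comm y m] at *
  rcases le_max_iff.1 h1 with h | h <;> constructor <;> linarith

/-- The constant speed parametrisation of a segment by `[0, 1]`. -/
theorem exists_path (x y : X) : ∃ γ : ℝ → X, γ 0 = x ∧ γ 1 = y ∧
    (∀ t ∈ Set.Icc (0 : ℝ) 1, IsBetween x (γ t) y) ∧
    ∀ s ∈ Set.Icc (0 : ℝ) 1, ∀ t ∈ Set.Icc (0 : ℝ) 1, dist (γ s) (γ t) = |s - t| * dist x y := by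
  obtain ⟨γ, g0, g1, h⟩ := exists_geodesic x y
  have hd : 0 ≤ dist x y := dist_nonneg
  have hm : ∀ t ∈ Set.Icc (0 : ℝ) 1, t * dist x y ∈ Set.Icc 0 (dist x y) := fun t ht =>
    ⟨mul_nonneg ht.1 hd, mul_le_of_le_one_left hd ht.2⟩
  have hdist : ∀ s ∈ Set.Icc (0 : ℝ) 1, ∀ t ∈ Set.Icc (0 : ℝ) 1,
      dist (γ (s * dist x y)) (γ (t * dist x y)) = |s - t| * dist x y := fun s hs t ht => by
    rw [h _ (hm s hs) _ (hm t ht), ← sub_mul, abs_mul, abs_of_nonneg hd]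
  refine ⟨fun t => γ (t * dist x y), by simp [g0], by simp [g1], fun t ht => ?_, hdist⟩
  have e1 := hdist 0 ⟨le_rfl, zero_le_one⟩ t ht
  have e2 := hdist t ht 1 ⟨zero_le_one, le_rfl⟩
  simp only [zero_mul, one_mul, g0, g1, zero_sub, abs_neg, abs_of_nonneg ht.1] at e1 e2
  rw [abs_of_nonpos (by linarith [ht.2])] at e2
  unfold IsBetween
  rw [e1, e2]; ring

omit [IsRTree X] in
theorem continuousOn_of_dist_eq {γ : ℝ → X} {L : ℝ}
    (h : ∀ s ∈ Set.Icc (0 : ℝ) 1, ∀ t ∈ Set.Icc (0 : ℝ) 1, dist (γ s) (γ t) = |s - t| * L) :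
    ContinuousOn γ (Set.Icc 0 1) := by
  refine (LipschitzOnWith.of_dist_le_mul (K := L.toNNReal) fun s hs t ht => ?_).continuousOn
  rw [h s hs t ht, Real.dist_eq, mul_comm]
  exact mul_le_mul_of_nonneg_right (Real.le_coe_toNNReal L) (abs_nonneg _)

theorem isNondegenerateArc_segment {x y : X} (hxy : x ≠ y) :
    IsNondegenerateArc {c | IsBetween x c y} := by
  refine ⟨⟨x, isBetween_left x y, y, isBetween_right x y, hxy⟩, 0, dist x y, ?_⟩
  obtain ⟨γ, g0, g1, h⟩ := exists_geodesic x y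
  have hb : ∀ t : Set.Icc 0 (dist x y), IsBetween x (γ t) y := fun t => by
    have e1 := h 0 ⟨le_rfl, dist_nonneg⟩ t t.2
    have e2 := h t t.2 (dist x y) ⟨dist_nonneg, le_rfl⟩
    rw [g0, zero_sub, abs_neg, abs_of_nonneg t.2.1] at e1
    rw [g1, abs_of_nonpos (by linarith [t.2.2])] at e2
    unfold IsBetween; linarith
  let F : Set.Icc 0 (dist x y) → {c | IsBetween x c y} := fun t => ⟨γ t, hb t⟩
  have hF : Isometry F := Isometry.of_dist_eq fun s t => by
    rw [Subtype.dist_eq, Subtype.dist_eq, Real.dist_eq]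
    exact h s s.2 t t.2
  have hs : Function.Surjective F := fun ⟨c, hc⟩ => by
    have hm : dist x c ∈ Set.Icc 0 (dist x y) := ⟨dist_nonneg, hc.dist_le_left⟩
    refine ⟨⟨dist x c, hm⟩, Subtype.ext ?_⟩
    refine eq_of_isBetween (hb ⟨dist x c, hm⟩) hc ?_
    have e1 := h 0 ⟨le_rfl, dist_nonneg⟩ _ hm
    rw [g0, zero_sub, abs_neg, abs_of_nonneg hm.1] at e1
    exact e1
  exact ⟨⟨Equiv.ofBijective F ⟨hF.injective, hs⟩, hF⟩⟩

end IsRTree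

/-! ### The metric completion of an `ℝ`-tree -/

section Completion

open UniformSpace

theorem Continuous.gromovProduct {Z X : Type*} [TopologicalSpace Z] [MetricSpace X] {f g h : Z → X}
    (hf : Continuous f) (hg : Continuous g) (hh : Continuous h) :
    Continuous fun z => gromovProduct (f z) (g z) (h z) := by
  unfold _root_.gromovProduct; fun_prop

variable {T : Type*} [MetricSpace T]

theorem exists_seq_tendsto_completion (x : Completion T) :
    ∃ u : ℕ → T, Tendsto (fun n => (u n : Completion T)) atTop (𝓝 x) := by
  obtain ⟨v, hv, hx⟩ := mem_closure_iff_seq_limit.1 (Completion.denseRange_coe (α := T) x)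
  choose u hu using hv
  exact ⟨u, by simpa only [hu] using hx⟩

theorem isometry_coe_completion : Isometry ((↑) : T → Completion T) := Completion.coe_isometry

theorem gromovProduct_coe (p x y : T) :
    gromovProduct (p : Completion T) x y = gromovProduct p x y := by
  simp only [gromovProduct, Completion.dist_eq]

variable [IsRTree T]

theorem completion_zero_hyperbolic (p x y z : Completion T) :
    min (gromovProduct p x y) (gromovProduct p y z) ≤ gromovProduct p x z := by
  obtain ⟨p', hp⟩ := exists_seq_tendsto_completion p
  obtain ⟨x', hx⟩ := exists_seq_tendsto_completion x
  obtain ⟨y', hy⟩ := exists_seq_tendsto_completion y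
  obtain ⟨z', hz⟩ := exists_seq_tendsto_completion z
  have hG : ∀ {a b c : ℕ → T} {a' b' c' : Completion T},
      Tendsto (fun n => (a n : Completion T)) atTop (𝓝 a') →
      Tendsto (fun n => (b n : Completion T)) atTop (𝓝 b') →
      Tendsto (fun n => (c n : Completion T)) atTop (𝓝 c') →
      Tendsto (fun n => gromovProduct (a n) (b n) (c n)) atTop (𝓝 (gromovProduct a' b' c')) := by
    intro a b c a' b' c' ha hb hc
    refine Tendsto.congr (fun n => gromovProduct_coe _ _ _) ?_
    exact (Continuous.gromovProduct (f := fun q : Completion T × Completion T × Completion T => q.1)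
      (g := fun q => q.2.1) (h := fun q => q.2.2) (by fun_prop) (by fun_prop)
      (by fun_prop)).continuousAt.tendsto.comp (ha.prodMk_nhds (hb.prodMk_nhds hc))
  exact le_of_tendsto_of_tendsto' ((hG hp hx hy).min (hG hp hy hz)) (hG hp hx hz)
    fun n => IsRTree.zero_hyperbolic _ _ _ _

/-- Geodesics of the completion are limits of geodesics of `T`, which form a Cauchy sequence by the
four point condition. -/
theorem completion_exists_geodesic (x y : Completion T) : ∃ γ : ℝ → Completion T,
    γ 0 = x ∧ γ (dist x y) = y ∧
    ∀ s ∈ Set.Icc 0 (dist x y), ∀ t ∈ Set.Icc 0 (dist x y), dist (γ s) (γ t) = |s - t| := by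
  obtain ⟨u, hu⟩ := exists_seq_tendsto_completion x
  obtain ⟨v, hv⟩ := exists_seq_tendsto_completion y
  choose g hg0 hg1 hg using fun n => IsRTree.exists_geodesic (u n) (v n)
  have hD : Tendsto (fun n => dist (u n) (v n)) atTop (𝓝 (dist x y)) := by
    simpa only [Completion.dist_eq] using hu.dist hv
  let c : ℕ → ℝ → T := fun n t => g n (min t (dist (u n) (v n)))
  have hmem : ∀ n t, 0 ≤ t → min t (dist (u n) (v n)) ∈ Set.Icc 0 (dist (u n) (v n)) :=
    fun n t ht => ⟨le_min ht dist_nonneg, min_le_right _ _⟩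
  have hc1 : ∀ n t, 0 ≤ t → dist (u n) (c n t) = min t (dist (u n) (v n)) := fun n t ht => by
    have := hg n 0 ⟨le_rfl, dist_nonneg⟩ _ (hmem n t ht)
    rw [hg0, zero_sub, abs_neg, abs_of_nonneg (hmem n t ht).1] at this
    exact this
  have hc2 : ∀ n t, 0 ≤ t → dist (c n t) (v n) = dist (u n) (v n) - min t (dist (u n) (v n)) :=
    fun n t ht => by
      have := hg n _ (hmem n t ht) _ ⟨dist_nonneg, le_rfl⟩
      rw [hg1, abs_of_nonpos (by linarith [(hmem n t ht).2])] at this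
      linarith
  have hcauchy : ∀ t, 0 ≤ t → CauchySeq fun n => c n t := by
    intro t ht
    have hb : ∀ n m, dist (c n t) (c m t) ≤ 4 * (dist (u n) (u m) + dist (v n) (v m)) := by
      intro n m
      have h4 := IsRTree.four_point (u n) (c n t) (v n) (c m t)
      have a1 := hc1 n t ht
      have a2 := hc2 n t ht
      have a3 := hc1 m t ht
      have a4 := hc2 m t ht
      have t1 := dist_triangle (u n) (u m) (c m t)
      have t2 := dist_triangle (v n) (v m) (c m t)
      have t3 : dist (u n) (v n) ≤ dist (u n) (u m) + dist (u m) (v m) + dist (v m) (v n) :=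
        dist_triangle4 _ _ _ _
      have t4 : dist (u m) (v m) ≤ dist (u m) (u n) + dist (u n) (v n) + dist (v n) (v m) :=
        dist_triangle4 _ _ _ _
      have p1 : 0 ≤ dist (u n) (u m) := dist_nonneg
      have p2 : 0 ≤ dist (v n) (v m) := dist_nonneg
      simp only [dist_comm (u m) (u n), dist_comm (v m) (v n), dist_comm (v m) (c m t)] at *
      rcases le_total t (dist (u n) (v n)) with hn | hn <;>
      rcases le_total t (dist (u m) (v m)) with hm | hm <;>
      simp only [min_eq_left hn, min_eq_right hn, min_eq_left hm, min_eq_right hm] at * <;>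
      rcases le_max_iff.1 h4 with h | h <;> linarith
    rw [Metric.cauchySeq_iff]
    intro ε hε
    obtain ⟨N₁, h₁⟩ := Metric.cauchySeq_iff.1 hu.cauchySeq (ε / 8) (by positivity)
    obtain ⟨N₂, h₂⟩ := Metric.cauchySeq_iff.1 hv.cauchySeq (ε / 8) (by positivity)
    refine ⟨max N₁ N₂, fun n hn m hm => (hb n m).trans_lt ?_⟩
    have e1 := h₁ n (le_of_max_le_left hn) m (le_of_max_le_left hm)
    have e2 := h₂ n (le_of_max_le_right hn) m (le_of_max_le_right hm)
    rw [Completion.dist_eq] at e1 e2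
    linarith
  have hlim : ∀ t, ∃ z : Completion T, 0 ≤ t →
      Tendsto (fun n => (c n t : Completion T)) atTop (𝓝 z) := by
    intro t
    by_cases ht : 0 ≤ t
    · obtain ⟨z, hz⟩ := cauchySeq_tendsto_of_complete
        ((Completion.uniformContinuous_coe T).comp_cauchySeq (hcauchy t ht))
      exact ⟨z, fun _ => hz⟩
    · exact ⟨x, fun h => absurd h ht⟩
  choose γ hγ using hlim
  refine ⟨γ, ?_, ?_, ?_⟩
  · refine tendsto_nhds_unique (hγ 0 le_rfl) (hu.congr fun n => ?_)
    simp only [c]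
    rw [min_eq_left dist_nonneg, hg0]
  · refine tendsto_nhds_unique (hγ _ dist_nonneg) ?_
    refine tendsto_iff_dist_tendsto_zero.2 ?_
    have h0 : Tendsto (fun n => (dist (u n) (v n) - min (dist x y) (dist (u n) (v n)))
        + dist (v n : Completion T) y) atTop (𝓝 ((dist x y - min (dist x y) (dist x y)) + dist y y)) :=
      (hD.sub (tendsto_const_nhds.min hD)).add (hv.dist tendsto_const_nhds)
    rw [min_self, sub_self, dist_self, add_zero] at h0
    refine squeeze_zero (fun _ => dist_nonneg) (fun n => ?_) h0
    have e := Completion.dist_eq (c n (dist x y)) (v n)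
    have := dist_triangle (c n (dist x y) : Completion T) (v n) y
    rwa [e, hc2 n _ dist_nonneg] at this
  · intro s hs t ht
    refine tendsto_nhds_unique ((hγ s hs.1).dist (hγ t ht.1)) ?_
    have hst : Tendsto (fun n => |min s (dist (u n) (v n)) - min t (dist (u n) (v n))|) atTop
        (𝓝 |min s (dist x y) - min t (dist x y)|) :=
      ((tendsto_const_nhds.min hD).sub (tendsto_const_nhds.min hD)).abs
    rw [min_eq_left hs.2, min_eq_left ht.2] at hst
    refine hst.congr fun n => ?_
    rw [Completion.dist_eq]
    exact (hg n _ (hmem n s hs.1) _ (hmem n t ht.1)).symm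

instance : IsRTree (Completion T) where
  nonempty := ⟨((IsRTree.nonempty (T := T)).some : Completion T)⟩
  exists_geodesic := completion_exists_geodesic
  zero_hyperbolic := completion_zero_hyperbolic

/-- The interior points of a segment of the completion belong to the tree itself. -/
theorem IsBetween.exists_coe {x c y : Completion T} (h : IsBetween x c y) (hx : c ≠ x)
    (hy : c ≠ y) : ∃ t : T, (t : Completion T) = c := by
  obtain ⟨x', hx'⟩ := Metric.denseRange_iff.1 (Completion.denseRange_coe (α := T)) x (dist x c)
    (dist_pos.2 hx.symm)
  obtain ⟨y', hy'⟩ := Metric.denseRange_iff.1 (Completion.denseRange_coe (α := T)) y (dist y c)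
    (dist_pos.2 hy.symm)
  have h1 := gromovProduct_pos_of_dist_lt hx'
  have h2 := gromovProduct_pos_of_dist_lt hy'
  have hb : IsBetween (x' : Completion T) c y' := by
    by_contra hc
    rw [← gromovProduct_pos_iff] at hc
    rw [gromovProduct_comm] at h2
    exact gromovProduct_pos_iff.1
      (IsRTree.gromovProduct_pos_trans (IsRTree.gromovProduct_pos_trans h1 hc) h2) h
  obtain ⟨t, ht, hd⟩ := IsRTree.exists_between x' y' (t := dist (x' : Completion T) c) dist_nonneg
    (by rw [← Completion.dist_eq x' y']; exact hb.dist_le_left)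
  refine ⟨t, IsRTree.eq_of_isBetween
    ((IsBetween.image_isometry isometry_coe_completion).2 ht) hb ?_⟩
  rw [Completion.dist_eq, hd]

end Completion

/-! ### Folded segments and indecomposability -/

theorem not_encard_le_two {α : Type*} {S : Set α} {a b c : α} (ha : a ∈ S) (hb : b ∈ S)
    (hc : c ∈ S) (hab : a ≠ b) (hac : a ≠ c) (hbc : b ≠ c) : ¬ S.encard ≤ 2 := by
  intro h
  have h3 : ({a, b, c} : Set α).encard = 3 := Set.encard_eq_three.2 ⟨a, b, c, hab, hac, hbc, rfl⟩
  have hle := Set.encard_le_encard (s := {a, b, c}) (t := S)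
    (by rintro x (rfl | rfl | rfl) <;> assumption)
  rw [h3] at hle
  exact absurd (hle.trans h) (by decide)

/-- An initial piece of an arc, without its end points, is an open interval. -/
theorem exists_isOpenInterval_near {Y : Type*} [TopologicalSpace Y] [T2Space Y]
    {f : unitInterval → Y} (hf : IsEmbedding f) {U : Set Y} (hU : IsOpen U) (h0 : f 0 ∈ U) :
    ∃ Z, IsOpenInterval Z ∧ ∀ z ∈ Z, z ∈ U ∧ z ≠ f 0 ∧ z ∈ Set.range f := by
  obtain ⟨ε, hε, hball⟩ := Metric.isOpen_iff.1 (hU.preimage hf.continuous) 0 h0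
  let δ : unitInterval := ⟨min 1 (ε / 2), by positivity, min_le_left _ _⟩
  have hδ0 : (0 : ℝ) < δ := lt_min one_pos (by positivity)
  have hδε : (δ : ℝ) < ε := lt_of_le_of_lt (min_le_right _ _) (by linarith)
  let k : unitInterval → Y := fun t => f (δ * t)
  have hk : Continuous k := hf.continuous.comp (by fun_prop)
  have hki : Function.Injective k := fun s t hst => by
    have := congrArg Subtype.val (hf.injective hst)
    exact Subtype.ext (mul_left_cancel₀ hδ0.ne' this)
  refine ⟨Set.range k \ {f 0, k 1}, ⟨Set.range k, f 0, k 1,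
    ⟨k, (hk.isClosedEmbedding hki).isEmbedding, by simp [k], rfl, rfl⟩, rfl⟩, ?_⟩
  rintro _ ⟨⟨t, rfl⟩, hne⟩
  simp only [Set.mem_insert_iff, Set.mem_singleton_iff, not_or] at hne
  refine ⟨hball ?_, hne.1, ⟨_, rfl⟩⟩
  rw [Metric.mem_ball, Subtype.dist_eq, Real.dist_eq]
  have h1 : ((δ * t : unitInterval) : ℝ) ≤ δ := mul_le_of_le_one_right hδ0.le t.2.2
  have h2 : 0 ≤ ((δ * t : unitInterval) : ℝ) := (δ * t).2.1
  have h3 : ((0 : unitInterval) : ℝ) = 0 := rfl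
  rw [h3, sub_zero, abs_of_nonneg h2]
  linarith

theorem IsRTree.isCompact_segment {T : Type*} [MetricSpace T] [IsRTree T] (x y : T) :
    IsCompact {c | IsBetween x c y} := by
  by_cases hxy : x = y
  · subst hxy
    have : {c | IsBetween x c x} = {x} := by
      ext c
      exact ⟨fun h => IsBetween.eq_of_self h, fun h => by
        rw [Set.mem_singleton_iff.1 h]; exact isBetween_left x x⟩
    rw [this]
    exact isCompact_singleton
  · obtain ⟨-, a, b, ⟨e⟩⟩ := IsRTree.isNondegenerateArc_segment hxy
    exact isCompact_iff_compactSpace.2 e.toHomeomorph.compactSpace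

section Folding

variable {T : Type*} [MetricSpace T] [IsRTree T] {Y : Type*} [TopologicalSpace Y] {q : T → Y}

/-- The image of the segment from `x` to `y` contains the arc between the images of its ends. -/
theorem IsDendrite.exists_isBetween_of_mem_arc (hY : IsDendrite Y) (hq : Continuous q) {x y : T}
    {A : Set Y} (hA : IsArcBetween A (q x) (q y)) (hne : q x ≠ q y) {z : Y} (hz : z ∈ A) :
    ∃ c, IsBetween x c y ∧ q c = z := by
  obtain ⟨γ, h0, h1, hb, hd⟩ := IsRTree.exists_path x y
  obtain ⟨t, ht, rfl⟩ := hY.arc_subset_image_path hA hne (f := fun t => q (γ t))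
    (hq.comp_continuousOn (IsRTree.continuousOn_of_dist_eq hd))
    (by simp only [h0]) (by simp only [h1]) hz
  exact ⟨γ t, hb t ht, rfl⟩

/-- The points of the tree whose projection to the segment from `s` to `s'` is an interior point of
that segment. -/
def middle (s s' : T) : Set T :=
  {a | 0 < gromovProduct s a s' ∧ 0 < gromovProduct s' a s}

/-- If a branch at an interior point of a folded segment had the same image as a point beyond the
end `s`, then all points of a small interval of `Y` at `q s` would have a preimage on each of the
two halves of the folded segment and a third one beyond `s`. -/
theorem false_of_middle_of_beyond (hY : IsDendrite Y) (hq : Continuous q)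
    (hthin : ∀ Z, IsOpenInterval Z → ∃ z ∈ Z, (q ⁻¹' {z}).encard ≤ 2) {s s' a a' : T}
    (hss : q s = q s') (hfib : ∀ c, q c = q s → c = s ∨ c = s') (ha : a ∈ middle s s')
    (ha' : IsBetween a' s s') (haa : q a = q a') : False := by
  have := hY.metrizable
  have hus : q a ≠ q s := fun h => by
    rcases hfib a h with h | h
    · have h1 := ha.1
      rw [h, gromovProduct_pos_iff] at h1
      exact h1 (isBetween_left _ _)
    · have h1 := ha.2
      rw [h, gromovProduct_pos_iff] at h1
      exact h1 (isBetween_left _ _)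
  obtain ⟨B, ⟨f, hf, hf0, hf1, hfB⟩, -⟩ := (hY.uniqueArc _ _ hus.symm)
  have hB : IsArcBetween B (q s) (q a) := ⟨f, hf, hf0, hf1, hfB⟩
  obtain ⟨m, hm1, hm2, hm3⟩ := IsRTree.exists_median a s s'
  have hms : m ≠ s := fun h => gromovProduct_pos_iff.1 ha.1 (h ▸ hm2)
  have hms' : m ≠ s' := fun h => gromovProduct_pos_iff.1 ha.2 (h ▸ hm1)
  have hK : IsCompact (q '' {c | IsBetween a c m}) := (IsRTree.isCompact_segment a m).image hq
  have hsK : q s ∉ q '' {c | IsBetween a c m} := by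
    rintro ⟨c, hc, hcs⟩
    have hac : ∀ d, IsBetween a m d → m ≠ d → c ≠ d := by
      rintro d hd hmd rfl
      have h1 : 0 < dist m c := dist_pos.2 hmd
      have h2 : 0 ≤ dist c m := dist_nonneg
      have h3 : dist a c + dist c m = dist a m := hc
      have h4 : dist a m + dist m c = dist a c := hd
      linarith
    rcases hfib c hcs with h | h
    · exact hac s hm1 hms h
    · exact hac s' hm2 hms' h
  obtain ⟨Z, hZ, hZU⟩ := exists_isOpenInterval_near hf hK.isClosed.isOpen_compl
    (by rw [hf0]; exact hsK)
  obtain ⟨z, hzZ, hz2⟩ := hthin Z hZ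
  obtain ⟨hzK, hz0, hzB⟩ := hZU z hzZ
  rw [hfB] at hzB
  rw [hf0] at hz0
  -- A preimage of `z` on the segment from `a` to an end of the folded segment is beyond `m`.
  have hbeyond : ∀ d, IsBetween a m d → q s = q d → ∃ c, IsBetween m c d ∧ c ≠ m ∧ q c = z := by
    intro d hd hqd
    obtain ⟨c, hc, hcz⟩ := hY.exists_isBetween_of_mem_arc hq (x := d) (y := a) (A := B)
      (hqd ▸ hB) (hqd ▸ hus.symm) hzB
    have hcK : ¬ IsBetween a c m := fun h => hzK ⟨c, h, hcz⟩
    rcases le_total (dist a c) (dist a m) with h | h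
    · exact absurd (IsRTree.isBetween_of_dist_le hc.symm hd h).1 hcK
    · refine ⟨c, (IsRTree.isBetween_of_dist_le hd hc.symm h).2, ?_, hcz⟩
      rintro rfl
      exact hcK (isBetween_right _ _)
  obtain ⟨c₁, hb1, hn1, hq1⟩ := hbeyond s hm1 rfl
  obtain ⟨c₂, hb2, hn2, hq2⟩ := hbeyond s' hm2 hss
  obtain ⟨c₃, hb3, hq3⟩ := hY.exists_isBetween_of_mem_arc hq (x := s) (y := a') (A := B)
    (haa ▸ hB) (haa ▸ hus.symm) hzB
  have hn3 : c₃ ≠ s := by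
    rintro rfl
    exact hz0 hq3.symm
  have h12 : c₁ ≠ c₂ := by
    rintro rfl
    have h1 : 0 < dist m c₁ := dist_pos.2 hn1.symm
    have t1 := dist_triangle s c₁ s'
    unfold IsBetween at hb1 hb2 hm3
    rw [dist_comm s m] at hm3
    rw [dist_comm s c₁] at t1
    linarith
  have h3 : ∀ c, IsBetween s c s' → c ≠ c₃ := by
    intro c hc hcc
    rw [hcc] at hc
    have h1 : 0 < dist c₃ s := dist_pos.2 hn3
    have t1 := dist_triangle a' c₃ s'
    unfold IsBetween at hb3 hc ha'
    rw [dist_comm s c₃] at hc hb3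
    rw [dist_comm s a', dist_comm c₃ a'] at hb3
    linarith
  exact not_encard_le_two (a := c₁) (b := c₂) (c := c₃) hq1 hq2 hq3 h12
    (h3 _ (IsRTree.isBetween_trans_left hm3 hb1.symm).1)
    (h3 _ (IsRTree.isBetween_trans_right hm3 hb2).1) hz2

/-- If `s` and `s'` are the only preimages of a point, then the set of points that project to the
interior of the segment between them is a union of fibres. -/
theorem mem_middle_of_eq (hY : IsDendrite Y) (hq : Continuous q)
    (hthin : ∀ Z, IsOpenInterval Z → ∃ z ∈ Z, (q ⁻¹' {z}).encard ≤ 2) {s s' a a' : T}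
    (hss : q s = q s') (hfib : ∀ c, q c = q s → c = s ∨ c = s') (ha : a ∈ middle s s')
    (haa : q a = q a') : a' ∈ middle s s' := by
  by_contra hc
  rw [middle, Set.mem_ofPred_eq, not_and_or, gromovProduct_pos_iff, gromovProduct_pos_iff, not_not,
    not_not] at hc
  rcases hc with hc | hc
  · exact false_of_middle_of_beyond hY hq hthin hss hfib ha hc haa
  · exact false_of_middle_of_beyond hY hq hthin hss.symm
      (fun c h => (hfib c (h.trans hss.symm)).symm) ⟨ha.2, ha.1⟩ hc haa

/-- A segment of the same length as the folded segment from `s` to `s'`, whose ends have the same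
image, cannot leave the direction of `s'` at `s` through `s`: by its length, the end in that
direction would be in the middle of the folded segment, and so would the other end, which is not
even in that direction. -/
theorem pos_or_eq_of_isBetween (hY : IsDendrite Y) (hq : Continuous q)
    (hthin : ∀ Z, IsOpenInterval Z → ∃ z ∈ Z, (q ⁻¹' {z}).encard ≤ 2) {s s' α β t t' : T}
    (hss : q s = q s') (hfib : ∀ c, q c = q s → c = s ∨ c = s') (hlen : dist α β = dist s s')
    (hαβ : q α = q β) (ht : IsBetween α t β) (htd : 0 < gromovProduct s t s')
    (ht' : IsBetween α t' β) : 0 < gromovProduct s t' s' ∨ t' = s := by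
  by_contra! hc
  obtain ⟨hc1, hc2⟩ := hc
  wlog hle : dist α t ≤ dist α t' generalizing α β
  · refine this (dist_comm β α ▸ hlen) hαβ.symm ht.symm ht'.symm ?_
    have e1 : dist α t + dist t β = dist α β := ht
    have e2 : dist α t' + dist t' β = dist α β := ht'
    rw [dist_comm β t, dist_comm β t']
    linarith
  have hts : s ≠ t := by
    rintro rfl
    exact gromovProduct_pos_iff.1 htd (isBetween_left _ _)
  have htt : IsBetween t s t' := by
    by_contra h
    rw [← gromovProduct_pos_iff, gromovProduct_comm] at h
    exact hc1.not_gt (IsRTree.gromovProduct_pos_trans h htd)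
  obtain ⟨b1, -⟩ := IsRTree.isBetween_of_dist_le ht ht' hle
  obtain ⟨b2, b3⟩ := IsRTree.isBetween_trans_right b1 htt
  obtain ⟨b4, b5⟩ := IsRTree.isBetween_trans_left ht' b2
  have hα1 : 0 < gromovProduct s α s' := by
    refine IsRTree.gromovProduct_pos_trans ?_ htd
    rw [gromovProduct_comm, b3.symm.gromovProduct_eq]
    exact dist_pos.2 hts
  have hβ : ¬ 0 < gromovProduct s β s' := fun h => by
    rw [gromovProduct_comm] at h
    exact gromovProduct_pos_iff.1 (IsRTree.gromovProduct_pos_trans hα1 h) b4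
  have hα2 : 0 < gromovProduct s' α s := by
    rw [gromovProduct_pos_iff]
    intro h
    have e1 : dist α s' + dist s' s = dist α s := h
    have e2 : dist α s + dist s β = dist α β := b4
    have e3 : 0 ≤ dist α s' := dist_nonneg
    rw [dist_comm s' s] at e1
    have e4 : dist s β = 0 := le_antisymm (by linarith) dist_nonneg
    rw [← dist_eq_zero.1 e4] at b5
    exact hc2 b5.eq_of_self
  exact hβ (mem_middle_of_eq hY hq hthin hss hfib ⟨hα1, hα2⟩ hαβ).1

variable {G : Type*} [Group G] [MulAction G T] [MulAction G Y]

omit [TopologicalSpace Y] in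
/-- An equivariant map that is constant on a nondegenerate arc of an indecomposable tree is
constant: by a chain of overlapping translates, it is constant on every arc. -/
theorem eq_of_const_on_arc (hind : IsIndecomposable G T)
    (hequiv : ∀ (g : G) (x : T), q (g • x) = g • q x) {J : Set T} (hJ : IsNondegenerateArc J) {b : Y}
    (hb : ∀ x ∈ J, q x = b) (x y : T) : q x = q y := by
  by_cases hxy : x = y
  · rw [hxy]
  obtain ⟨r, g, hcov, hov⟩ := hind _ J (IsRTree.isNondegenerateArc_segment hxy) hJ
  have hconst : ∀ i, ∀ t ∈ (fun x => g i • x) '' J, q t = g i • b := by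
    rintro i _ ⟨c, hc, rfl⟩
    rw [hequiv, hb c hc]
  have hall : ∀ i, g i • b = g 0 • b := by
    intro i
    induction i using Fin.induction with
    | zero => rfl
    | succ i ih =>
      obtain ⟨t, ht⟩ := (hov i).nonempty
      rw [← hconst _ t ht.2, hconst _ t ht.1, ih]
  obtain ⟨i, hi⟩ := Set.mem_iUnion.1 (hcov (isBetween_left x y))
  obtain ⟨j, hj⟩ := Set.mem_iUnion.1 (hcov (isBetween_right x y))
  rw [hconst i x hi, hconst j y hj, hall i, hall j]

/-- In an indecomposable tree there is no folded segment, with ends `s` and `s'` forming a full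
fibre, that can be prolonged beyond `s` to some `e`: no translate of the folded segment crosses `s`,
so a chain of translates cannot lead from `s'` to `e`. -/
theorem false_of_folded_segment [IsIsometricSMul G T] (hY : IsDendrite Y) (hq : Continuous q)
    (hind : IsIndecomposable G T) (hequiv : ∀ (g : G) (x : T), q (g • x) = g • q x)
    (hthin : ∀ Z, IsOpenInterval Z → ∃ z ∈ Z, (q ⁻¹' {z}).encard ≤ 2) {s s' e : T}
    (hss : q s = q s') (hfib : ∀ c, q c = q s → c = s ∨ c = s') (hne : s ≠ s') (hes : e ≠ s)
    (he : IsBetween e s s') : False := by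
  have hes' : e ≠ s' := by
    rintro rfl
    exact hes he.eq_of_self.symm
  obtain ⟨r, g, hcov, hov⟩ := hind _ _ (IsRTree.isNondegenerateArc_segment hes')
    (IsRTree.isNondegenerateArc_segment hne)
  let P : Fin (r + 1) → Prop := fun i =>
    ∃ t ∈ (fun x => g i • x) '' {c | IsBetween s c s'}, 0 < gromovProduct s t s'
  have hPQ : ∀ i, P i → ∀ t ∈ (fun x => g i • x) '' {c | IsBetween s c s'},
      0 < gromovProduct s t s' ∨ t = s := by
    rintro i ⟨_, ⟨c, hc, rfl⟩, hpos⟩ _ ⟨c', hc', rfl⟩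
    have hb : ∀ d, IsBetween s d s' → IsBetween (g i • s) (g i • d) (g i • s') := fun d hd =>
      (IsBetween.image_isometry (isometry_smul T (g i))).2 hd
    exact pos_or_eq_of_isBetween hY hq hthin hss hfib (dist_smul (g i) s s')
      (by rw [hequiv, hequiv, hss]) (hb c hc) hpos (hb c' hc')
  have hstep : ∀ i j, P i → (((fun x => g i • x) '' {c | IsBetween s c s'}) ∩
      ((fun x => g j • x) '' {c | IsBetween s c s'})).Nontrivial → P j := by
    rintro i j hi ⟨t, ht, t', ht', htt⟩
    rcases hPQ i hi t ht.1 with h | h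
    · exact ⟨t, ht.2, h⟩
    rcases hPQ i hi t' ht'.1 with h' | h'
    · exact ⟨t', ht'.2, h'⟩
    · exact absurd (h.trans h'.symm) htt
  have hall : ∀ i, P i ↔ P 0 := by
    intro i
    induction i using Fin.induction with
    | zero => rfl
    | succ i ih =>
      rw [← ih]
      exact ⟨fun h => hstep _ _ h (Set.inter_comm _ _ ▸ hov i), fun h => hstep _ _ h (hov i)⟩
  obtain ⟨i, hi⟩ := Set.mem_iUnion.1 (hcov (isBetween_right e s'))
  obtain ⟨j, hj⟩ := Set.mem_iUnion.1 (hcov (isBetween_left e s'))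
  have hPi : P i := ⟨s', hi, by rw [gromovProduct_self]; exact dist_pos.2 hne⟩
  rcases hPQ j ((hall j).2 ((hall i).1 hPi)) e hj with h | h
  · exact gromovProduct_pos_iff.1 h he
  · exact hes h

end Folding

/-! ### The weak topology on `T̂` -/

section RTree

variable {X : Type*} [MetricSpace X]

theorem gromovProduct_le_add_dist_left (p x x' y : X) :
    gromovProduct p x y ≤ gromovProduct p x' y + dist x x' := by
  have h1 := dist_triangle x x' p
  have h2 := dist_triangle x' x y
  rw [dist_comm x' x] at h2
  unfold gromovProduct; linarith

theorem IsRTree.isBetween_of_dist_le_gromovProduct [IsRTree X] {o c x y : X} (h : IsBetween o c x)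
    (hd : dist o c ≤ gromovProduct o x y) : IsBetween o c y := by
  have h1 := IsRTree.four_point o c x y
  have t1 := dist_triangle o c y
  unfold gromovProduct at hd
  unfold IsBetween at *
  rw [dist_comm x o, dist_comm y o] at hd
  rcases le_max_iff.1 h1 with h2 | h2 <;> linarith

end RTree

section Sequences

open UniformSpace

variable {T : Type*} [MetricSpace T]

/-- A sequence that converges at infinity does so as seen from every point of the completion. -/
theorem GromovSeq.exists_le (u : GromovSeq T) (o : Completion T) (C : ℝ) :
    ∃ N, ∀ n ≥ N, ∀ m ≥ N, C ≤ gromovProduct o (u.1 n : Completion T) (u.1 m) := by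
  obtain ⟨p, hp⟩ := Metric.denseRange_iff.1 (Completion.denseRange_coe (α := T)) o 1 one_pos
  obtain ⟨⟨N, M⟩, h⟩ := eventually_atTop.1 (tendsto_atTop.1 (u.2 p) (C + 1))
  refine ⟨max N M, fun n hn m hm => ?_⟩
  have h1 := h (n, m) ⟨le_of_max_le_left hn, le_of_max_le_right hm⟩
  rw [← gromovProduct_coe] at h1
  have h2 := gromovProduct_le_add_dist (p : Completion T) o (u.1 n) (u.1 m)
  rw [dist_comm] at h2
  simp only at h1
  linarith

theorem GromovSeq.exists_le_of_rel [IsRTree T] {u v : GromovSeq T}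
    (h : Quotient.mk (gromovSeqSetoid T) u = Quotient.mk (gromovSeqSetoid T) v)
    (o : Completion T) (C : ℝ) :
    ∃ N, ∀ n ≥ N, ∀ m ≥ N, C ≤ gromovProduct o (u.1 n : Completion T) (v.1 m) := by
  obtain ⟨p, hp⟩ := Metric.denseRange_iff.1 (Completion.denseRange_coe (α := T)) o 1 one_pos
  obtain ⟨N, hN⟩ := eventually_atTop.1 (tendsto_atTop.1 (Quotient.exact h p) (C + 1))
  obtain ⟨M, hM⟩ := u.exists_le o C
  refine ⟨max N M, fun n hn m hm => ?_⟩
  have h1 := hN m (le_of_max_le_left hm)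
  rw [← gromovProduct_coe] at h1
  have h2 := gromovProduct_le_add_dist (p : Completion T) o (u.1 m) (v.1 m)
  rw [dist_comm] at h2
  have h3 := hM n (le_of_max_le_right hn) m (le_of_max_le_right hm)
  refine (le_min h3 ?_).trans (IsRTree.zero_hyperbolic o (u.1 n : Completion T) (u.1 m) (v.1 m))
  linarith

/-- A boundary point is the end of a ray from any given point of the completion. -/
theorem GromovSeq.exists_ray [IsRTree T] (u : GromovSeq T) (o : Completion T) :
    ∃ γ : ℝ → Completion T, γ 0 = o ∧ (∀ s ≥ 0, ∀ t ≥ 0, dist (γ s) (γ t) = |s - t|) ∧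
      ∀ r ≥ 0, ∀ᶠ n in atTop, IsBetween o (γ r) (u.1 n) := by
  choose N hN using u.exists_le o
  have hex : ∀ r : ℝ, ∃ c : Completion T, 0 ≤ r →
      IsBetween o c (u.1 (N r)) ∧ dist o c = r := by
    intro r
    by_cases hr : 0 ≤ r
    · have h1 := hN r (N r) le_rfl (N r) le_rfl
      rw [gromovProduct_self] at h1
      obtain ⟨c, hc⟩ := IsRTree.exists_between o (u.1 (N r) : Completion T) hr h1
      exact ⟨c, fun _ => hc⟩
    · exact ⟨o, fun h => absurd h hr⟩
  choose γ hγ using hex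
  have hb : ∀ r ≥ 0, ∀ n ≥ N r, IsBetween o (γ r) (u.1 n) := fun r hr n hn =>
    IsRTree.isBetween_of_dist_le_gromovProduct (hγ r hr).1
      ((hγ r hr).2.le.trans (hN r (N r) le_rfl n hn))
  have hle : ∀ s t, 0 ≤ s → s ≤ t → dist (γ s) (γ t) = t - s := fun s t hs hst => by
    have ht := hs.trans hst
    have h1 := (IsRTree.isBetween_of_dist_le (hb s hs _ (le_max_left (N s) (N t)))
      (hb t ht _ (le_max_right (N s) (N t))) (by rw [(hγ s hs).2, (hγ t ht).2]; exact hst)).1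
    unfold IsBetween at h1
    rw [(hγ s hs).2, (hγ t ht).2] at h1
    linarith
  refine ⟨γ, ?_, fun s hs t ht => ?_, fun r hr =>
    eventually_atTop.2 ⟨N r, fun n hn => hb r hr n hn⟩⟩
  · exact (dist_eq_zero.1 (hγ 0 le_rfl).2).symm
  · rcases le_total s t with h | h
    · rw [hle s t hs h, abs_of_nonpos (by linarith)]; ring
    · rw [dist_comm, hle t s ht h, abs_of_nonneg (by linarith)]

end Sequences

namespace WeakHat

open UniformSpace

variable {T : Type*} [MetricSpace T] [IsRTree T]

theorem reps_nonempty (η : WeakHat T) : (reps η).Nonempty := by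
  cases η with
  | pt x => exact ⟨_, rfl⟩
  | bdry ξ =>
    obtain ⟨u, hu⟩ := Quotient.exists_rep ξ
    exact ⟨_, u, hu, rfl⟩

theorem pt_mem_direction_pt {c x : Completion T} {η : WeakHat T} :
    pt x ∈ direction (pt c) η ↔ ∀ u ∈ reps η, ∀ᶠ n in atTop, 0 < gromovProduct c (u n) x :=
  ⟨fun h u hu => h u hu _ rfl, fun h u hu v hv => by
    rw [Set.mem_singleton_iff.1 hv]; exact h u hu⟩

theorem direction_pt_eq {c : Completion T} {η ζ : WeakHat T} (h : ζ ∈ direction (pt c) η) :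
    direction (pt c) η = direction (pt c) ζ := by
  ext θ
  constructor
  · intro h' u hu w hw
    obtain ⟨v, hv⟩ := reps_nonempty η
    filter_upwards [h v hv u hu, h' v hv w hw] with n h1 h2
    rw [gromovProduct_comm] at h1
    exact IsRTree.gromovProduct_pos_trans h1 h2
  · intro h' u hu w hw
    obtain ⟨v, hv⟩ := reps_nonempty ζ
    filter_upwards [h u hu v hv, h' v hv w hw] with n h1 h2
    exact IsRTree.gromovProduct_pos_trans h1 h2

theorem continuous_pt : Continuous (pt : Completion T → WeakHat T) := by
  refine continuous_generateFrom_iff.2 ?_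
  rintro _ ⟨x, η, hη, rfl⟩
  cases x with
  | bdry ξ =>
    have : pt ⁻¹' direction (bdry ξ) η = (Set.univ : Set (Completion T)) :=
      Set.eq_univ_of_forall fun x => ⟨hη, nofun⟩
    rw [this]
    exact isOpen_univ
  | pt c =>
    refine Metric.isOpen_iff.2 fun x hx => ?_
    rw [Set.mem_preimage, pt_mem_direction_pt] at hx
    have hxc : x ≠ c := by
      rintro rfl
      obtain ⟨u, hu⟩ := reps_nonempty η
      obtain ⟨n, hn⟩ := (hx u hu).exists
      exact gromovProduct_pos_iff.1 hn (isBetween_right _ _)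
    refine ⟨dist x c, dist_pos.2 hxc, fun x' hx' => pt_mem_direction_pt.2 fun u hu => ?_⟩
    filter_upwards [hx u hu] with n hn
    rw [Metric.mem_ball, dist_comm] at hx'
    exact IsRTree.gromovProduct_pos_trans hn (gromovProduct_pos_of_dist_lt hx')

/-- Convergence to a boundary point in the metric sense implies convergence in the weak topology. -/
theorem tendsto_bdry {ι : Type*} {l : Filter ι} {f : ι → Completion T} {u : GromovSeq T}
    (o : Completion T)
    (h : ∀ C : ℝ, ∀ᶠ i in l, ∀ᶠ n in atTop, C ≤ gromovProduct o (f i) (u.1 n : Completion T)) :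
    Tendsto (fun i => pt (f i)) l (𝓝 (bdry (Quotient.mk (gromovSeqSetoid T) u))) := by
  refine TopologicalSpace.tendsto_nhds_generateFrom_iff.2 ?_
  rintro _ ⟨x, η, hη, rfl⟩ hmem
  cases x with
  | bdry ξ => exact univ_mem' fun i => ⟨hη, nofun⟩
  | pt c =>
    filter_upwards [h (dist o c + 1)] with i hi
    refine pt_mem_direction_pt.2 fun v hv => ?_
    filter_upwards [hi, hmem v hv _ ⟨u, rfl, rfl⟩] with n h1 h2
    refine IsRTree.gromovProduct_pos_trans h2 ?_
    rw [gromovProduct_comm]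
    linarith [gromovProduct_le_add_dist o c (f i) (u.1 n : Completion T)]

/-- A point `ζ` outside the direction of `o` at `c` lies behind `c` as seen from `o`. For a boundary
point, not being in the direction says only that `c` lies between `o` and infinitely many terms of
one representing sequence; the same then holds eventually for all representing sequences, because
their Gromov products at `c` tend to infinity. -/
theorem eventually_isBetween_of_notMem {o c : Completion T} {ζ : WeakHat T}
    (h : ζ ∉ direction (pt c) (pt o)) {v : ℕ → Completion T} (hv : v ∈ reps ζ) :
    ∀ᶠ n in atTop, IsBetween o c (v n) := by
  have h' : ∃ w ∈ reps ζ, ∃ᶠ n in atTop, IsBetween o c (w n) := by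
    by_contra! hc
    refine h fun u hu w hw => ?_
    rw [Set.mem_singleton_iff.1 hu]
    filter_upwards [hc w hw] with n hn
    exact gromovProduct_pos_iff.2 hn
  obtain ⟨w, hw, hf⟩ := h'
  cases ζ with
  | pt x =>
    obtain ⟨n, hn⟩ := hf.exists
    rw [Set.mem_singleton_iff.1 hw] at hn
    rw [Set.mem_singleton_iff.1 hv]
    exact .of_forall fun _ => hn
  | bdry ξ =>
    obtain ⟨u₁, rfl, rfl⟩ := hv
    obtain ⟨u₂, h2, rfl⟩ := hw
    obtain ⟨N, hN⟩ := GromovSeq.exists_le_of_rel h2.symm c 1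
    obtain ⟨m, hmb, hmN⟩ := (hf.and_eventually (eventually_ge_atTop N)).exists
    filter_upwards [eventually_ge_atTop N] with n hn
    by_contra hc
    exact gromovProduct_pos_iff.1 (IsRTree.gromovProduct_pos_trans (gromovProduct_pos_iff.2 hc)
      (one_pos.trans_le (hN n hn m hmN))) hmb

theorem notMem_direction_of_frequently {o c : Completion T} {ζ : WeakHat T}
    {v : ℕ → Completion T} (hv : v ∈ reps ζ) (hf : ∃ᶠ n in atTop, IsBetween o c (v n)) :
    ζ ∉ direction (pt c) (pt o) := fun h =>
  hf ((h _ rfl v hv).mono fun _ hn => gromovProduct_pos_iff.1 hn)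

/-- The limit of a chain of points: if the points of `B` are totally ordered as seen from `o`, there
is a point of `T̂` behind all of them to which some of them are arbitrarily close. -/
theorem exists_limit_of_chain {o : Completion T} {B : Set (Completion T)} (hne : B.Nonempty)
    (hchain : ∀ c ∈ B, ∀ c' ∈ B, dist o c ≤ dist o c' → IsBetween o c c') :
    ∃ ζ : WeakHat T, (∀ c ∈ B, ζ ∉ direction (pt c) (pt o)) ∧
      ∀ U : Set (WeakHat T), IsOpen U → ζ ∈ U → ∃ c ∈ B, pt c ∈ U := by
  have hdist : ∀ c ∈ B, ∀ c' ∈ B, dist c c' = |dist o c - dist o c'| := by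
    intro c hc c' hc'
    rcases le_total (dist o c) (dist o c') with h | h
    · have h1 : dist o c + dist c c' = dist o c' := hchain c hc c' hc' h
      rw [abs_of_nonpos (by linarith)]; linarith
    · have h1 : dist o c' + dist c' c = dist o c := hchain c' hc' c hc h
      rw [abs_of_nonneg (by linarith), dist_comm]; linarith
  by_cases hb : BddAbove (dist o '' B)
  · obtain ⟨d, -, hd, hdS⟩ := exists_seq_tendsto_sSup (hne.image (dist o)) hb
    choose c hcB hcd using hdS
    have hcauchy : CauchySeq c := by
      refine Metric.cauchySeq_iff.2 fun ε hε => ?_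
      obtain ⟨N, hN⟩ := Metric.cauchySeq_iff.1 hd.cauchySeq ε hε
      refine ⟨N, fun m hm n hn => ?_⟩
      rw [hdist _ (hcB m) _ (hcB n), hcd, hcd, ← Real.dist_eq]
      exact hN m hm n hn
    obtain ⟨x, hx⟩ := cauchySeq_tendsto_of_complete hcauchy
    have hox : dist o x = sSup (dist o '' B) :=
      tendsto_nhds_unique (tendsto_const_nhds.dist hx) (by simpa only [hcd] using hd)
    refine ⟨pt x, fun a ha => ?_, fun U hU hxU => ?_⟩
    · refine notMem_direction_of_frequently (v := fun _ => x) rfl (Frequently.of_forall fun _ => ?_)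
      have h1 : dist a x = |dist o a - sSup (dist o '' B)| := by
        refine tendsto_nhds_unique (tendsto_const_nhds.dist hx)
          ((tendsto_const_nhds.sub hd).abs.congr fun n => ?_)
        rw [hdist a ha _ (hcB n), hcd]
      have h2 := le_csSup hb (Set.mem_image_of_mem (dist o) ha)
      rw [abs_of_nonpos (by linarith)] at h1
      unfold IsBetween
      linarith
    · obtain ⟨n, hn⟩ := (hx.eventually (continuous_pt.continuousAt.eventually
        (hU.mem_nhds hxU))).exists
      exact ⟨c n, hcB n, hn⟩
  · have hunb : ∀ n : ℕ, ∃ c ∈ B, (n : ℝ) < dist o c := by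
      intro n
      by_contra! hc
      exact hb ⟨n, by rintro _ ⟨c, hcB, rfl⟩; exact hc c hcB⟩
    choose c hcB hcn using hunb
    choose u hu using fun n => Metric.denseRange_iff.1 (Completion.denseRange_coe (α := T)) (c n) 1
      one_pos
    have hcu : ∀ n m : ℕ, min (n : ℝ) (m : ℝ) - 1 ≤ gromovProduct o (c n) (u m : Completion T) := by
      intro n m
      have h1 := gromovProduct_le_add_dist_left o (c m) (u m : Completion T) (c n)
      have h2 : min (n : ℝ) (m : ℝ) ≤ gromovProduct o (c m) (c n) := by
        rcases le_total (dist o (c n)) (dist o (c m)) with h | h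
        · rw [gromovProduct_comm, (hchain _ (hcB n) _ (hcB m) h).gromovProduct_eq]
          exact (min_le_left _ _).trans (hcn n).le
        · rw [(hchain _ (hcB m) _ (hcB n) h).gromovProduct_eq]
          exact (min_le_right _ _).trans (hcn m).le
      rw [gromovProduct_comm o (u m : Completion T)] at h1
      linarith [hu m]
    have huu : ∀ n m : ℕ, min (n : ℝ) (m : ℝ) - 2 ≤ gromovProduct o (u n : Completion T) (u m) := by
      intro n m
      have h1 := gromovProduct_le_add_dist_left o (c n) (u n : Completion T) (u m)
      linarith [hu n, hcu n m]
    let w : GromovSeq T := ⟨u, fun p => tendsto_atTop.2 fun C => by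
      obtain ⟨N, hN⟩ := exists_nat_ge (C + 2 + dist o p)
      filter_upwards [eventually_ge_atTop ((N, N) : ℕ × ℕ)] with k hk
      have h1 := huu k.1 k.2
      have h2 := gromovProduct_le_add_dist o (p : Completion T) (u k.1) (u k.2)
      rw [gromovProduct_coe] at h2
      have h3 : (N : ℝ) ≤ min (k.1 : ℝ) k.2 :=
        le_min (Nat.cast_le.2 hk.1) (Nat.cast_le.2 hk.2)
      linarith⟩
    refine ⟨bdry (Quotient.mk _ w), fun a ha => ?_, fun U hU hxU => ?_⟩
    · refine notMem_direction_of_frequently (v := fun n => (u n : Completion T)) ⟨w, rfl, rfl⟩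
        (Eventually.frequently ?_)
      obtain ⟨N, hN⟩ := exists_nat_ge (dist o a + 1)
      filter_upwards [eventually_ge_atTop N] with n hn
      have h1 : dist o a + 1 ≤ dist o (c n) :=
        (hN.trans (Nat.cast_le.2 hn)).trans (hcn n).le
      have h2 := hchain a ha _ (hcB n) (by linarith)
      by_contra hc
      rw [← gromovProduct_pos_iff] at hc
      refine gromovProduct_pos_iff.1 (IsRTree.gromovProduct_pos_trans hc ?_) h2
      rw [gromovProduct_comm]
      refine gromovProduct_pos_of_dist_lt ((hu n).trans_le ?_)
      unfold IsBetween at h2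
      rw [dist_comm]
      linarith
    · have ht : Tendsto (fun n => pt (c n)) atTop (𝓝 (bdry (Quotient.mk _ w))) := by
        refine tendsto_bdry o fun C => ?_
        obtain ⟨N, hN⟩ := exists_nat_ge (C + 1)
        filter_upwards [eventually_ge_atTop N] with k hk
        filter_upwards [eventually_ge_atTop N] with n hn
        have h3 : (N : ℝ) ≤ min (k : ℝ) n := le_min (Nat.cast_le.2 hk) (Nat.cast_le.2 hn)
        linarith [hcu k n]
      obtain ⟨n, hn⟩ := (ht.eventually (hU.mem_nhds hxU)).exists
      exact ⟨c n, hcB n, hn⟩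

/-- Compactness of `T̂`, by Alexander's subbasis theorem: in a cover by directions no two of which
cover, the base points of the members that contain a fixed point `o` form a chain, and a member that
contains the limit of the chain covers `T̂` together with a member of the chain. -/
instance : CompactSpace (WeakHat T) := by
  refine compactSpace_generateFrom rfl fun P hP hcov => ?_
  by_contra hfin
  have hmem : ∀ ζ : WeakHat T, ∃ D ∈ P, ζ ∈ D := fun ζ => by
    have : ζ ∈ ⋃₀ P := hcov ▸ Set.mem_univ ζ
    exact this
  have hpair : ∀ D ∈ P, ∀ D' ∈ P, ∃ ζ, ζ ∉ D ∧ ζ ∉ D' := by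
    intro D hD D' hD'
    by_contra! hc
    refine hfin ⟨{D, D'}, by rintro _ (rfl | rfl) <;> assumption, Set.toFinite _, ?_⟩
    rw [Set.sUnion_pair]
    refine Set.eq_univ_of_forall fun ζ => ?_
    by_cases h : ζ ∈ D
    · exact Or.inl h
    · exact Or.inr (hc ζ h)
  have hpt : ∀ D ∈ P, ∃ c η, D = direction (pt c) η := by
    intro D hD
    obtain ⟨x, η, hη, rfl⟩ := hP hD
    cases x with
    | pt c => exact ⟨c, η, rfl⟩
    | bdry ξ =>
      obtain ⟨D', hD', hξ⟩ := hmem (bdry ξ)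
      obtain ⟨ζ, h1, h2⟩ := hpair _ hD D' hD'
      refine absurd (show ζ ∈ direction (bdry ξ) η from ⟨hη, ?_⟩) h1
      rintro rfl
      exact h2 hξ
  obtain ⟨o⟩ := IsRTree.nonempty (T := Completion T)
  let B : Set (Completion T) := {c | direction (pt c) (pt o) ∈ P}
  have hBmem : ∀ c η, direction (pt c) η ∈ P → pt o ∈ direction (pt c) η → c ∈ B := by
    intro c η hD ho
    rw [direction_pt_eq ho] at hD
    exact hD
  have hBne : B.Nonempty := by
    obtain ⟨D, hD, ho⟩ := hmem (pt o)
    obtain ⟨c, η, rfl⟩ := hpt D hD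
    exact ⟨c, hBmem c η hD ho⟩
  obtain ⟨ζ, hζ1, hζ2⟩ := exists_limit_of_chain (o := o) hBne fun c hc c' hc' hle => by
    obtain ⟨ζ, h1, h2⟩ := hpair _ hc _ hc'
    obtain ⟨v, hv⟩ := reps_nonempty ζ
    obtain ⟨n, hn1, hn2⟩ := ((eventually_isBetween_of_notMem h1 hv).and
      (eventually_isBetween_of_notMem h2 hv)).exists
    exact (IsRTree.isBetween_of_dist_le hn1 hn2 hle).1
  obtain ⟨D, hD, hζD⟩ := hmem ζ
  obtain ⟨c, hcB, hcD⟩ := hζ2 D (TopologicalSpace.isOpen_generateFrom_of_mem (hP hD)) hζD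
  obtain ⟨e, η, rfl⟩ := hpt D hD
  have ho : pt o ∉ direction (pt e) η := fun ho =>
    hζ1 e (hBmem e η hD ho) (direction_pt_eq ho ▸ hζD)
  rw [direction_pt_eq hcD] at ho hD hcD
  have hec : e ≠ c := by
    rintro rfl
    obtain ⟨n, hn⟩ := (pt_mem_direction_pt.1 hcD _ rfl).exists
    exact gromovProduct_pos_iff.1 hn (isBetween_left _ _)
  obtain ⟨n, hn⟩ := (eventually_isBetween_of_notMem ho (v := fun _ => o) rfl).exists
  obtain ⟨θ, h1, h2⟩ := hpair _ hD _ hcB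
  obtain ⟨v, hv⟩ := reps_nonempty θ
  obtain ⟨m, hm1, hm2⟩ := ((eventually_isBetween_of_notMem h1 hv).and
    (eventually_isBetween_of_notMem h2 hv)).exists
  have h3 := (IsRTree.isBetween_trans_left hm2 hn.symm).2
  have h4 : 0 < dist e c := dist_pos.2 hec
  unfold IsBetween at h3 hm1
  rw [dist_comm c e] at hm1
  linarith

end WeakHat

/-! ### Geodesics in `T̂` and injectivity -/

section Geodesics

open UniformSpace WeakHat

variable {T : Type*} [MetricSpace T] [IsRTree T]

/-- `γ` parametrises a half-open geodesic of the completion by `[0, 1)` (not necessarily at constant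
speed), and converges to the point `x` of `T̂` at `1`. -/
structure IsGeodesicTo (γ : ℝ → Completion T) (x : WeakHat T) : Prop where
  between : ∀ r s t, 0 ≤ r → r ≤ s → s ≤ t → t < 1 → IsBetween (γ r) (γ s) (γ t)
  ne : ∀ s t, 0 ≤ s → s < t → t < 1 → γ s ≠ γ t
  continuousOn : ContinuousOn γ (Set.Ico 0 1)
  tendsto : Tendsto (fun t => pt (γ t)) (𝓝[<] 1) (𝓝 x)

theorem exists_isGeodesicTo_pt {o x : Completion T} (hox : o ≠ x) :
    ∃ γ, γ 0 = o ∧ IsGeodesicTo γ (pt x) := by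
  obtain ⟨γ, h0, h1, -, hd⟩ := IsRTree.exists_path o x
  have hc := IsRTree.continuousOn_of_dist_eq hd
  refine ⟨γ, h0, fun r s t hr hrs hst ht => ?_, fun s t hs hst ht => ?_,
    hc.mono Set.Ico_subset_Icc_self, ?_⟩
  · unfold IsBetween
    rw [hd r ⟨hr, by linarith⟩ s ⟨by linarith, by linarith⟩,
      hd s ⟨by linarith, by linarith⟩ t ⟨by linarith, by linarith⟩,
      hd r ⟨hr, by linarith⟩ t ⟨by linarith, by linarith⟩,
      abs_of_nonpos (by linarith), abs_of_nonpos (by linarith), abs_of_nonpos (by linarith)]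
    ring
  · rw [← dist_pos, hd s ⟨hs, by linarith⟩ t ⟨by linarith, by linarith⟩]
    exact mul_pos (abs_pos.2 (by linarith)) (dist_pos.2 hox)
  · have h := hc 1 ⟨zero_le_one, le_rfl⟩
    rw [ContinuousWithinAt, h1] at h
    refine (continuous_pt.continuousAt.tendsto.comp h).mono_left ?_
    rw [← nhdsWithin_Ico_eq_nhdsLT (zero_lt_one (α := ℝ))]
    exact nhdsWithin_mono _ Set.Ico_subset_Icc_self

theorem strictMono_div_one_sub {s t : ℝ} (hst : s < t) (ht : t < 1) :
    s / (1 - s) < t / (1 - t) := by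
  rw [div_lt_div_iff₀ (by linarith) (by linarith)]
  nlinarith

theorem isGeodesicTo_bdry {ρ : ℝ → Completion T} {u : GromovSeq T}
    (hd : ∀ s ≥ 0, ∀ t ≥ 0, dist (ρ s) (ρ t) = |s - t|)
    (hb : ∀ r ≥ 0, ∀ᶠ n in atTop, IsBetween (ρ 0) (ρ r) (u.1 n)) :
    IsGeodesicTo (fun t => ρ (t / (1 - t))) (bdry (Quotient.mk (gromovSeqSetoid T) u)) := by
  have h0 : ∀ t : ℝ, 0 ≤ t → t < 1 → 0 ≤ t / (1 - t) := fun t h h' =>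
    div_nonneg h (by linarith)
  have hm : ∀ s t : ℝ, s ≤ t → t < 1 → s / (1 - s) ≤ t / (1 - t) := fun s t hst ht => by
    rcases hst.eq_or_lt with rfl | h
    · rfl
    · exact (strictMono_div_one_sub h ht).le
  refine ⟨fun r s t hr hrs hst ht => ?_, fun s t hs hst ht => ?_, ?_, ?_⟩
  · have e1 := hm r s hrs (by linarith)
    have e2 := hm s t hst ht
    have e3 := h0 r hr (by linarith)
    unfold IsBetween
    rw [hd _ e3 _ (by linarith), hd _ (by linarith) _ (by linarith), hd _ e3 _ (by linarith),
      abs_of_nonpos (by linarith), abs_of_nonpos (by linarith), abs_of_nonpos (by linarith)]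
    ring
  · have e1 := strictMono_div_one_sub hst ht
    rw [← dist_pos, hd _ (h0 s hs (by linarith)) _ (h0 t (by linarith) ht)]
    exact abs_pos.2 (by linarith)
  · have h1 : ContinuousOn ρ (Set.Ici 0) := by
      refine (LipschitzOnWith.of_dist_le_mul (K := 1) fun s hs t ht => ?_).continuousOn
      rw [hd s hs t ht, Real.dist_eq, NNReal.coe_one, one_mul]
    refine h1.comp ?_ fun t ht => h0 t ht.1 ht.2
    exact continuousOn_id.div (by fun_prop) fun t ht => by linarith [ht.2]
  · have hlim : Tendsto (fun t : ℝ => t / (1 - t)) (𝓝[<] 1) atTop := by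
      have e1 : Tendsto (fun t : ℝ => 1 - t) (𝓝[<] 1) (𝓝[>] 0) := by
        refine tendsto_nhdsWithin_iff.2 ⟨?_, ?_⟩
        · have : Tendsto (fun t : ℝ => 1 - t) (𝓝 1) (𝓝 (1 - 1)) :=
            (continuous_const.sub continuous_id).tendsto 1
          rw [sub_self] at this
          exact this.mono_left nhdsWithin_le_nhds
        · filter_upwards [self_mem_nhdsWithin] with t ht
          exact sub_pos.2 (Set.mem_Iio.1 ht)
      have e2 : Tendsto (fun t : ℝ => t) (𝓝[<] 1) (𝓝 1) := nhdsWithin_le_nhds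
      exact e2.pos_mul_atTop one_pos (tendsto_inv_nhdsGT_zero.comp e1)
    have ht : Tendsto (fun r => pt (ρ r)) atTop
        (𝓝 (bdry (Quotient.mk (gromovSeqSetoid T) u))) := by
      refine tendsto_bdry (ρ 0) fun C => ?_
      filter_upwards [eventually_ge_atTop (max C 0)] with r hr
      have hr0 : 0 ≤ r := le_of_max_le_right hr
      filter_upwards [hb r hr0] with n hn
      rw [hn.gromovProduct_eq, hd 0 le_rfl r hr0, zero_sub, abs_neg, abs_of_nonneg hr0]
      exact le_of_max_le_left hr
    exact ht.comp hlim

namespace IsGeodesicTo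

variable {γ : ℝ → Completion T} {x : WeakHat T}

/-- The interior points of a geodesic belong to the tree itself. -/
theorem exists_coe (h : IsGeodesicTo γ x) {t : ℝ} (h0 : 0 < t) (h1 : t < 1) :
    ∃ a : T, (a : Completion T) = γ t :=
  IsBetween.exists_coe (h.between 0 t ((1 + t) / 2) le_rfl h0.le (by linarith) (by linarith))
    (h.ne 0 t le_rfl h0 h1).symm (h.ne t _ h0.le (by linarith) (by linarith))

/-- The geodesic with its end point added is a path in `T̂`. -/
theorem continuousOn_update (h : IsGeodesicTo γ x) :
    ContinuousOn (Function.update (fun t => pt (γ t)) 1 x) (Set.Icc 0 1) := by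
  rw [continuousOn_update_iff, Set.Icc_sdiff_right]
  refine ⟨continuous_pt.comp_continuousOn h.continuousOn, fun _ => ?_⟩
  rw [nhdsWithin_Ico_eq_nhdsLT zero_lt_one]
  exact h.tendsto

end IsGeodesicTo

end Geodesics

section DendriteMaps

open UniformSpace WeakHat

variable {G : Type*} [Group G] {T : Type*} [MetricSpace T] [IsRTree T] [MulAction G T]
  [IsIsometricSMul G T] {Y : Type*} [TopologicalSpace Y] [MulAction G Y] {p : WeakHat T → Y}

theorem injective_pt_coe : Function.Injective fun t : T => pt (t : Completion T) :=
  fun _ _ h => Completion.coe_injective T (WeakHat.pt.inj h)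

/-- The two ends of a geodesic have different images: otherwise the geodesic would be folded, and
would contain a folded segment whose ends form a full fibre. -/
theorem IsGeodesicTo.map_ne (hY : IsDendrite Y) (hp : Continuous p)
    (hind : IsIndecomposable G T) (hequiv : ∀ (g : G) (x : WeakHat T), p (g • x) = g • p x)
    (hthin : ∀ Z, IsOpenInterval Z → ∃ z ∈ Z, (p ⁻¹' {z}).encard ≤ 2)
    (hnc : ∃ a b : T, p (pt a) ≠ p (pt b)) {γ : ℝ → Completion T} {x : WeakHat T}
    (hγ : IsGeodesicTo γ x) : p (pt (γ 0)) ≠ p x := by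
  intro heq
  let q : T → Y := fun t => p (pt t)
  have hq : Continuous q := hp.comp (continuous_pt.comp (Completion.continuous_coe T))
  have hqe : ∀ (g : G) (t : T), q (g • t) = g • q t := fun g t => by
    rw [← hequiv]
    exact congrArg (fun z => p (pt z)) (Completion.coe_smul g t)
  have hqthin : ∀ Z, IsOpenInterval Z → ∃ z ∈ Z, (q ⁻¹' {z}).encard ≤ 2 := fun Z hZ => by
    obtain ⟨z, hz, hz2⟩ := hthin Z hZ
    refine ⟨z, hz, le_trans ?_ hz2⟩
    rw [← injective_pt_coe.encard_image]
    exact Set.encard_le_encard (Set.image_preimage_subset _ (p ⁻¹' {z}))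
  -- The image is not constant along the geodesic.
  obtain ⟨t₀, ht0, ht1, hv⟩ : ∃ t₀, 0 < t₀ ∧ t₀ < 1 ∧ p (pt (γ t₀)) ≠ p x := by
    obtain ⟨a₁, ha1⟩ := hγ.exists_coe (t := 1 / 3) (by norm_num) (by norm_num)
    obtain ⟨a₂, ha2⟩ := hγ.exists_coe (t := 2 / 3) (by norm_num) (by norm_num)
    have ha : a₁ ≠ a₂ := by
      rintro rfl
      exact hγ.ne (1 / 3) (2 / 3) (by norm_num) (by norm_num) (by norm_num) (ha1.symm.trans ha2)
    obtain ⟨c, hc, hcx⟩ : ∃ c, IsBetween a₁ c a₂ ∧ q c ≠ p x := by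
      by_contra! hcon
      obtain ⟨a, b, hab⟩ := hnc
      exact hab (eq_of_const_on_arc hind hqe (IsRTree.isNondegenerateArc_segment ha) hcon a b)
    have hc' : IsBetween (γ (1 / 3)) (c : Completion T) (γ (2 / 3)) := by
      rw [← ha1, ← ha2]
      exact (IsBetween.image_isometry isometry_coe_completion).2 hc
    have hcont : ContinuousOn (fun t => dist (γ (1 / 3)) (γ t)) (Set.Icc (1 / 3) (2 / 3)) :=
      (continuous_const.dist continuous_id).comp_continuousOn (hγ.continuousOn.mono fun t ht =>
        ⟨by linarith [ht.1], by linarith [ht.2]⟩)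
    obtain ⟨t, ht, htd⟩ := intermediate_value_Icc (by norm_num) hcont
      (show dist (γ (1 / 3)) (c : Completion T) ∈ _ from
        ⟨by simp, hc'.dist_le_left⟩)
    have : γ t = c := IsRTree.eq_of_isBetween
      (hγ.between _ _ _ (by norm_num) ht.1 ht.2 (by norm_num)) hc' htd
    exact ⟨t, by linarith [ht.1], by linarith [ht.2], by rw [this]; exact hcx⟩
  obtain ⟨A, hA, -⟩ := hY.uniqueArc _ _ hv
  obtain ⟨z, ⟨hzA, hz⟩, hz2⟩ := hthin _ ⟨A, _, _, hA, rfl⟩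
  simp only [Set.mem_insert_iff, Set.mem_singleton_iff, not_or] at hz
  let τ : ℝ → WeakHat T := Function.update (fun t => pt (γ t)) 1 x
  have hτ : ContinuousOn (fun t => p (τ t)) (Set.Icc 0 1) :=
    hp.comp_continuousOn hγ.continuousOn_update
  have hτ1 : τ 1 = x := Function.update_self ..
  have hτt : ∀ t < 1, τ t = pt (γ t) := fun t ht => Function.update_of_ne ht.ne _ _
  -- The arc from `p (γ t₀)` to `p x` is covered on both sides of `t₀`.
  obtain ⟨t₁, h1, h1', hz1⟩ : ∃ t, t₀ < t ∧ t < 1 ∧ p (pt (γ t)) = z := by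
    obtain ⟨t, ht, rfl⟩ := hY.arc_subset_image_path hA hv
      (f := fun t => p (τ (t₀ + t * (1 - t₀))))
      (hτ.comp (f := fun t => t₀ + t * (1 - t₀)) (by fun_prop) fun t ht =>
        ⟨by nlinarith [ht.1], by nlinarith [ht.2]⟩)
      (by simp [hτt t₀ ht1]) (by simp [hτ1]) hzA
    have hne0 : t ≠ 0 := by
      rintro rfl
      exact hz.1 (by simp [hτt t₀ ht1])
    have hne1 : t ≠ 1 := by
      rintro rfl
      exact hz.2 (by simp [hτ1])
    have hpos : 0 < t := lt_of_le_of_ne ht.1 hne0.symm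
    have hlt : t < 1 := lt_of_le_of_ne ht.2 hne1
    have h1 : t₀ + t * (1 - t₀) < 1 := by nlinarith
    exact ⟨_, by nlinarith, h1, congrArg p (hτt _ h1).symm⟩
  obtain ⟨t₂, h2, h2', hz2'⟩ : ∃ t, 0 < t ∧ t < t₀ ∧ p (pt (γ t)) = z := by
    obtain ⟨t, ht, rfl⟩ := hY.arc_subset_image_path hA hv
      (f := fun t => p (τ (t₀ * (1 - t))))
      (hτ.comp (f := fun t => t₀ * (1 - t)) (by fun_prop) fun t ht =>
        ⟨mul_nonneg ht0.le (by linarith [ht.2]), by nlinarith [ht.1]⟩)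
      (by simp [hτt t₀ ht1]) (by simp [hτt 0 one_pos, heq]) hzA
    have hne0 : t ≠ 0 := by
      rintro rfl
      exact hz.1 (by simp [hτt t₀ ht1])
    have hne1 : t ≠ 1 := by
      rintro rfl
      exact hz.2 (by simp [hτt 0 one_pos, heq])
    have hpos : 0 < t := lt_of_le_of_ne ht.1 hne0.symm
    have hlt : t < 1 := lt_of_le_of_ne ht.2 hne1
    have h1 : t₀ * (1 - t) < t₀ := by nlinarith
    exact ⟨_, mul_pos ht0 (by linarith), h1, congrArg p (hτt _ (h1.trans ht1)).symm⟩
  obtain ⟨s, hs⟩ := hγ.exists_coe h2 (h2'.trans ht1)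
  obtain ⟨s', hs'⟩ := hγ.exists_coe (ht0.trans h1) h1'
  obtain ⟨e, he⟩ := hγ.exists_coe (t := t₂ / 2) (by linarith) (by linarith)
  have hqs : q s = z := by rw [← hz2', ← hs]
  have hqs' : q s' = z := by rw [← hz1, ← hs']
  have hss : s ≠ s' := by
    rintro rfl
    exact hγ.ne t₂ t₁ h2.le (h2'.trans h1) h1' (hs.symm.trans hs')
  have hes : e ≠ s := by
    rintro rfl
    exact hγ.ne (t₂ / 2) t₂ (by linarith) (by linarith) (by linarith) (he.symm.trans hs)
  refine false_of_folded_segment hY hq hind hqe hqthin (hqs.trans hqs'.symm) (fun c hc => ?_) hss hes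
    ((IsBetween.image_isometry isometry_coe_completion).1 ?_)
  · by_contra! hcon
    exact not_encard_le_two (S := p ⁻¹' {z}) (a := pt c) (b := pt s) (c := pt s') (hc.trans hqs) hqs
      hqs' (injective_pt_coe.ne hcon.1) (injective_pt_coe.ne hcon.2) (injective_pt_coe.ne hss) hz2
  · rw [he, hs, hs']
    exact hγ.between _ _ _ (by linarith) (by linarith) (h2'.trans h1).le h1'

/-- If the ends of every geodesic have different images, then two boundary points with the same image
are equal: the rays towards them from a common point both run along one arc of the dendrite, so they
coincide. -/
theorem eq_of_map_bdry_eq (hY : IsDendrite Y) (hp : Continuous p)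
    (hne : ∀ (γ : ℝ → Completion T) (x : WeakHat T), IsGeodesicTo γ x → p (pt (γ 0)) ≠ p x)
    {u v : GromovSeq T} (heq : p (bdry (Quotient.mk (gromovSeqSetoid T) u)) =
      p (bdry (Quotient.mk (gromovSeqSetoid T) v))) :
    Quotient.mk (gromovSeqSetoid T) u = Quotient.mk (gromovSeqSetoid T) v := by
  have := hY.metrizable
  obtain ⟨o⟩ := IsRTree.nonempty (T := Completion T)
  have hinj : ∀ x y : Completion T, p (pt x) = p (pt y) → x = y := fun x y h => by
    by_contra hxy
    obtain ⟨γ, rfl, hγ⟩ := exists_isGeodesicTo_pt hxy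
    exact hne _ _ hγ h
  have hinj' : ∀ (x : Completion T) (w : GromovSeq T),
      p (pt x) ≠ p (bdry (Quotient.mk (gromovSeqSetoid T) w)) := fun x w => by
    obtain ⟨ρ, rfl, hd, hb⟩ := w.exists_ray x
    have := hne _ _ (isGeodesicTo_bdry hd hb)
    simpa using this
  obtain ⟨ρ₁, h10, hd1, hb1⟩ := u.exists_ray o
  obtain ⟨ρ₂, h20, hd2, hb2⟩ := v.exists_ray o
  have hγ1 := isGeodesicTo_bdry hd1 (h10.symm ▸ hb1)
  have hγ2 := isGeodesicTo_bdry hd2 (h20.symm ▸ hb2)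
  have hc1 := hp.comp_continuousOn hγ1.continuousOn_update
  have hc2 := hp.comp_continuousOn hγ2.continuousOn_update
  have hF : IsArcBetween (Set.range fun t : unitInterval =>
      p (Function.update (fun t => pt (ρ₁ (t / (1 - t)))) 1
        (bdry (Quotient.mk (gromovSeqSetoid T) u)) (t : ℝ))) (p (pt o))
      (p (bdry (Quotient.mk (gromovSeqSetoid T) u))) := by
    refine ⟨_, ((continuousOn_iff_continuous_domRestrict.1 hc1).isClosedEmbedding
      ?_).isEmbedding, ?_, ?_, rfl⟩
    · have key : ∀ s t : unitInterval, s < t →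
          p (Function.update (fun t => pt (ρ₁ (t / (1 - t)))) 1
            (bdry (Quotient.mk (gromovSeqSetoid T) u)) (s : ℝ)) ≠
          p (Function.update (fun t => pt (ρ₁ (t / (1 - t)))) 1
            (bdry (Quotient.mk (gromovSeqSetoid T) u)) (t : ℝ)) := by
        intro s t hst
        have hst' : (s : ℝ) < t := hst
        have hs1 : (s : ℝ) < 1 := hst'.trans_le t.2.2
        rw [Function.update_of_ne hs1.ne]
        rcases t.2.2.eq_or_lt with h | h
        · rw [h, Function.update_self]
          exact hinj' _ _
        · rw [Function.update_of_ne h.ne]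
          exact fun hpe => hγ1.ne s t s.2.1 hst' h (hinj _ _ hpe)
      intro s t hst
      rcases lt_trichotomy s t with h | h | h
      · exact absurd hst (key s t h)
      · exact h
      · exact absurd hst.symm (key t s h)
    · simp [Set.domRestrict, h10]
    · simp [Set.domRestrict]
  have hsub := hY.arc_subset_image_path hF (hinj' o u) hc2
    (by simp [h20]) (by simp [heq])
  -- So every point of the first ray lies on the second one, at the same distance from `o`.
  have hsame : ∀ r ≥ 0, ρ₁ r = ρ₂ r := by
    intro r hr
    have hr1 : r / (1 + r) < 1 := by rw [div_lt_one (by linarith)]; linarith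
    have hrr : r / (1 + r) / (1 - r / (1 + r)) = r := by
      have : 1 + r ≠ 0 := by linarith
      field_simp
      ring
    obtain ⟨t, ht, hte⟩ := hsub ⟨⟨r / (1 + r), div_nonneg hr (by linarith), hr1.le⟩, rfl⟩
    simp only [Function.comp_apply] at hte
    rw [Function.update_of_ne hr1.ne, hrr] at hte
    rcases ht.2.eq_or_lt with h | h
    · rw [h, Function.update_self] at hte
      exact absurd hte.symm (hinj' _ _)
    · rw [Function.update_of_ne h.ne] at hte
      have h3 := hinj _ _ hte
      have h4 : 0 ≤ t / (1 - t) := div_nonneg ht.1 (by linarith)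
      have h5 : dist (ρ₂ 0) (ρ₂ (t / (1 - t))) = dist (ρ₁ 0) (ρ₁ r) := by rw [h3, h10, h20]
      rw [hd2 0 le_rfl _ h4, hd1 0 le_rfl r hr, zero_sub, zero_sub, abs_neg, abs_neg,
        abs_of_nonneg h4, abs_of_nonneg hr] at h5
      rw [← h3, h5]
  refine Quotient.sound fun a => tendsto_atTop.2 fun C => ?_
  have hr0 : 0 ≤ max 0 (C + dist o (a : Completion T)) := le_max_left _ _
  have h1 := hb1 _ hr0
  have h2 := hb2 _ hr0
  filter_upwards [h1, h2] with n hn1 hn2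
  rw [← hsame _ hr0] at hn2
  have h3 := IsRTree.zero_hyperbolic o (u.1 n : Completion T)
    (ρ₁ (max 0 (C + dist o (a : Completion T)))) (v.1 n)
  rw [gromovProduct_comm o (u.1 n : Completion T), hn1.gromovProduct_eq, hn2.gromovProduct_eq,
    min_self] at h3
  have h4 := hd1 0 le_rfl _ hr0
  rw [h10, zero_sub, abs_neg, abs_of_nonneg hr0] at h4
  have h5 := gromovProduct_le_add_dist o (a : Completion T) (u.1 n) (v.1 n)
  rw [gromovProduct_coe] at h5
  have h6 := le_max_right 0 (C + dist o (a : Completion T))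
  linarith

/-- A continuous map to a Hausdorff space that is constant on the tree is constant on `T̂`. -/
theorem map_eq_of_const [T2Space Y] (hp : Continuous p) {y : Y}
    (h : ∀ t : T, p (pt t) = y) (ζ : WeakHat T) : p ζ = y := by
  have hX : ∀ x : Completion T, p (pt x) = y := fun x =>
    congrFun (Completion.ext (hp.comp continuous_pt) continuous_const (g := fun _ => y) h) x
  cases ζ with
  | pt x => exact hX x
  | bdry ξ =>
    obtain ⟨u, rfl⟩ := Quotient.exists_rep ξ
    obtain ⟨o⟩ := IsRTree.nonempty (T := Completion T)
    obtain ⟨ρ, rfl, hd, hb⟩ := u.exists_ray o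
    refine tendsto_nhds_unique
      ((hp.continuousAt.tendsto.comp (isGeodesicTo_bdry hd hb).tendsto).congr fun t => ?_)
      tendsto_const_nhds
    exact hX _

end DendriteMaps

theorem mainTheorem11 (N : ℕ) (T : Type*) [MetricSpace T] [IsRTree T]
    [MulAction (FreeGroup (Fin N)) T] [IsIsometricSMul (FreeGroup (Fin N)) T]
    (hT : MemOuterSpaceBoundary N T) (hind : IsIndecomposable (FreeGroup (Fin N)) T)
    (Y : Type*) [TopologicalSpace Y] (hY : IsDendrite Y)
    [MulAction (FreeGroup (Fin N)) Y] [ContinuousConstSMul (FreeGroup (Fin N)) Y]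
    (p : WeakHat T → Y) (hp : Continuous p) (hsurj : Function.Surjective p)
    (hequiv : ∀ (g : FreeGroup (Fin N)) (x : WeakHat T), p (g • x) = g • p x) :
    IsHomeomorph p ∨ (∃ y : Y, ∀ z : Y, z = y) ∨
      ∃ Z : Set Y, IsOpenInterval Z ∧ ∀ z ∈ Z, 2 < (p ⁻¹' {z}).encard := by
  have := hY.metrizable
  by_cases hthin : ∃ Z : Set Y, IsOpenInterval Z ∧ ∀ z ∈ Z, 2 < (p ⁻¹' {z}).encard
  · exact Or.inr (Or.inr hthin)
  push Not at hthin
  by_cases hnc : ∃ a b : T, p (WeakHat.pt a) ≠ p (WeakHat.pt b)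
  · left
    have hne : ∀ (γ : ℝ → UniformSpace.Completion T) (x : WeakHat T), IsGeodesicTo γ x →
        p (WeakHat.pt (γ 0)) ≠ p x :=
      fun γ x hγ => hγ.map_ne hY hp hind hequiv hthin hnc
    have hpb : ∀ (x : UniformSpace.Completion T) (ξ : GromovBoundary T),
        p (WeakHat.pt x) ≠ p (WeakHat.bdry ξ) := fun x ξ => by
      obtain ⟨u, rfl⟩ := Quotient.exists_rep ξ
      obtain ⟨ρ, rfl, hd, hb⟩ := u.exists_ray x
      simpa using hne _ _ (isGeodesicTo_bdry hd hb)
    refine isHomeomorph_iff_continuous_bijective.2 ⟨hp, fun x y hxy => ?_, hsurj⟩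
    cases x with
    | pt x =>
      cases y with
      | pt y =>
        by_contra hne'
        obtain ⟨γ, rfl, hγ⟩ := exists_isGeodesicTo_pt (o := x) (x := y) (fun h => hne' (h ▸ rfl))
        exact hne _ _ hγ hxy
      | bdry η => exact absurd hxy (hpb x η)
    | bdry ξ =>
      cases y with
      | pt y => exact absurd hxy.symm (hpb y ξ)
      | bdry η =>
        obtain ⟨u, rfl⟩ := Quotient.exists_rep ξ
        obtain ⟨v, rfl⟩ := Quotient.exists_rep η
        exact congrArg WeakHat.bdry (eq_of_map_bdry_eq hY hp hne hxy)
  · right; left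
    push Not at hnc
    obtain ⟨t₀⟩ := IsRTree.nonempty (T := T)
    refine ⟨p (WeakHat.pt t₀), fun z => ?_⟩
    obtain ⟨ζ, rfl⟩ := hsurj z
    exact map_eq_of_const hp (fun t => hnc t t₀) ζ
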